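/- Let $m$ be a positive integer, $\zeta_n := e^{2\pi i/n}$, and let $M$ be the set of all $m$-th roots of unity in the lattice $\mathbb{Z}[\zeta_m]$, which has rank $\phi(m)$. For $n\ge 0$ let $S(n)$ be the number of elements of $\mathbb{Z}[\zeta_m]$ of word length $n$ with respect to $M$, i.e. the elements that are a sum of $n$, but of no fewer than $n$, elements of $M$ (repetitions allowed). The coordinator polynomial of $\mathbb{Z}[\zeta_m]$ is the polynomial $h_m(x)$ with $$\sum_{n\ge 0} S(n)\,x^n = \frac{h_m(x)}{(1-x)^{\phi(m)}} .$$ Write $m=\prod_{p\mid m} p^{\alpha_p}$. The $\phi(m)$ products $\prod_{p\mid m}\zeta_{p^{\alpha_p}}^{\,k_p+j_p p^{\alpha_p-1}}$ with $0\le k_p<p^{\alpha_p-1}$ and $0\le j_p\le p-2$ form a lattice basis of $\mathbb{Z}[\zeta_m]$; identify them with the standard unit vectors of $\mathbb{R}^{\phi(m)}$. The cyclotomic polytope $\mathcal{C}_m\subset\mathbb{R}^{\phi(m)}$ is the convex hull of the $m$ lattice points that correspond to the $m$-th roots of unity. The $h$-polynomial of a $d$-dimensional polytope $P$ is $\sum_{k=0}^{d}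 f_{k-1}(P)\,(x-1)^{d-k}$, where $f_j(P)$ is the number of $j$-dimensional faces of $P$ and $f_{-1}(P)=1$ counts the empty face. $P$ is simplicial if all its proper faces are simplices. Corollary. If $\mathcal{C}_m$ is simplicial, then the coordinator polynomial of $\mathbb{Z}[\zeta_m]$ exists and equals the $h$-polynomial of $\mathcal{C}_m$, that is, $$(1-x)^{\phi(m)}\sum_{n\ge 0} S(n)\,x^n=\sum_{k=0}^{d} f_{k-1}(\mathcal{C}_m)\,(x-1)^{d-k},\qquad d=\dim \mathcal{C}_m .$$ -/

import Mathlib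

open scoped Polynomial

noncomputable section

namespace CyclotomicCoordinator

/-! ### Growth series of a lattice with respect to a generating set -/

/-- `x` is a sum of exactly `n` (not necessarily distinct) elements of `M`. -/
def IsSumOfTerms {L : Type*} [AddCommGroup L] (M : Set L) (x : L) (n : ℕ) : Prop :=
  ∃ s : Multiset L, s.card = n ∧ (∀ y ∈ s, y ∈ M) ∧ s.sum = x

/-- `x` has word length `n` with respect to `M`: the minimal number of terms in an expression of
`x` as a sum of elements of `M` is `n`. -/
def HasWordLength {L : Type*} [AddCommGroup L] (M : Set L) (x : L) (n : ℕ) : Prop :=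
  IsLeast {k : ℕ | IsSumOfTerms M x k} n

/-- The coordination sequence `S(n)`: the number of elements of word length `n`. -/
def coordinationSequence {L : Type*} [AddCommGroup L] (M : Set L) (n : ℕ) : ℕ :=
  Nat.card {x : L // HasWordLength M x n}

/-- The growth series `G(x) = ∑ S(n) xⁿ`. -/
def growthSeries {L : Type*} [AddCommGroup L] (M : Set L) : PowerSeries ℤ :=
  PowerSeries.mk fun n => (coordinationSequence M n : ℤ)

/-- `h` is the coordinator polynomial of `(L, M)`: `G(x) = h(x) / (1 - x)^r` with `r` the rank of
the lattice `L`. As `1 - x` is invertible in `ℤ⟦x⟧`, there is at most one such polynomial. -/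
def IsCoordinatorPolynomial {L : Type*} [AddCommGroup L] (M : Set L) (h : ℤ[X]) : Prop :=
  growthSeries M * (1 - PowerSeries.X) ^ Module.finrank ℤ L = (h : PowerSeries ℤ)

/-! ### The cyclotomic lattice and the cyclotomic polytope -/

/-- `ζ_m = exp(2πi/m)`. -/
def zeta (m : ℕ) : ℂ := Complex.exp (2 * Real.pi * Complex.I / m)

/-- The lattice `ℤ[ζ_m]`, as a subring of `ℂ`. -/
abbrev cyclotomicLattice (m : ℕ) : Subalgebra ℤ ℂ := Algebra.adjoin ℤ {zeta m}

/-- The set `M` of all `m`-th roots of unity, inside `ℤ[ζ_m]`. -/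
def latticeRootsOfUnity (m : ℕ) : Set (cyclotomicLattice m) := {x | x ^ m = 1}

/-- The index set of the chosen lattice basis: for every prime `p` with `p ^ α ∥ m`, a pair
`(k, j)` with `0 ≤ k < p ^ (α - 1)` and `0 ≤ j ≤ p - 2`. It has `φ(m)` elements. -/
abbrev BasisIndex (m : ℕ) : Type :=
  (p : m.primeFactors) → Fin ((p : ℕ) ^ (m.factorization p - 1)) × Fin ((p : ℕ) - 1)

/-- The chosen lattice basis of `ℤ[ζ_m]`: the products, over the primes `p` with `p ^ α ∥ m`, of
the basis elements `ζ_{p^α} ^ (k + j p ^ (α - 1))` of `ℤ[ζ_{p^α}]`. -/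
def basisElement (m : ℕ) (b : BasisIndex m) : ℂ :=
  ∏ p : m.primeFactors,
    zeta ((p : ℕ) ^ m.factorization p) ^
      (((b p).1 : ℕ) + ((b p).2 : ℕ) * (p : ℕ) ^ (m.factorization p - 1))

/-- The lattice vectors in `ℝ^{φ(m)}` that correspond to the `m`-th roots of unity when the chosen
lattice basis is identified with the standard unit vectors. -/
def rootVectors (m : ℕ) : Set (BasisIndex m → ℝ) :=
  {v | ∃ c : BasisIndex m → ℤ,
    (∑ b, (c b : ℂ) * basisElement m b) ^ m = 1 ∧ v = fun b => (c b : ℝ)}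

/-- The `m`-th cyclotomic polytope `C_m`. -/
def cyclotomicPolytope (m : ℕ) : Set (BasisIndex m → ℝ) :=
  convexHull ℝ (rootVectors m)

/-! ### Faces, simplicial polytopes and `h`-polynomials

For a polytope `P`, the predicate `IsExposed ℝ P F` says that `F` is a face of `P`: the empty set,
or the set of maximizers over `P` of some linear functional (the zero functional gives `P`). -/

/-- The dimension of (the affine span of) a set; the empty set has dimension `-1`. -/
def affineDim {E : Type*} [AddCommGroup E] [Module ℝ E] (F : Set E) : ℤ :=
  open Classical in if F = ∅ then -1 else (Module.finrank ℝ (vectorSpan ℝ F) : ℤ)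

/-- A simplex: the convex hull of finitely many affinely independent points. -/
def IsSimplex {E : Type*} [AddCommGroup E] [Module ℝ E] (F : Set E) : Prop :=
  ∃ s : Finset E, AffineIndependent ℝ ((↑) : s → E) ∧ F = convexHull ℝ (s : Set E)

/-- A polytope is simplicial if all its proper faces are simplices. -/
def IsSimplicial {E : Type*} [AddCommGroup E] [Module ℝ E] [TopologicalSpace E]
    (P : Set E) : Prop :=
  ∀ F : Set E, IsExposed ℝ P F → F ≠ P → IsSimplex F

/-- The face number `f_j`: the number of `j`-dimensional faces, with `f_{-1} = 1` counting the
empty face. -/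
def faceNumber {E : Type*} [AddCommGroup E] [Module ℝ E] [TopologicalSpace E]
    (P : Set E) (j : ℤ) : ℕ :=
  Nat.card {F : Set E // IsExposed ℝ P F ∧ affineDim F = j}

/-- The `h`-polynomial `∑_{k=0}^d f_{k-1} (x - 1)^{d-k}` of a polytope of dimension `d`. -/
def hPolynomial {E : Type*} [AddCommGroup E] [Module ℝ E] [TopologicalSpace E]
    (P : Set E) : ℤ[X] :=
  ∑ k ∈ Finset.range ((affineDim P).toNat + 1),
    Polynomial.C (faceNumber P ((k : ℤ) - 1) : ℤ) *
      (Polynomial.X - 1) ^ ((affineDim P).toNat - k)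

end CyclotomicCoordinator

end

open scoped Polynomial

noncomputable section

namespace CyclotomicCoordinator

/-! ### Fans over the faces of a point configuration -/

section Configuration

variable {ι E : Type*} [NormedAddCommGroup E] [NormedSpace ℝ E]
  {w : ι → E} {G H : Finset ι}

open Filter Topology

/-! Suppose first that m > 1, and put d = φ(m). The roots of unity sum to zero and span, so the
origin is interior to the polytope and the cones over its proper faces cover ℝ^d. Simpliciality
makes the vertices of every proper face linearly independent. If these cones are also unimodular for
the lattice, every lattice element is, for exactly one face G (possibly empty), a combination of the
vertices of G with positive integer coefficients. The functional that is 1 on G and at most 1 on all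
roots shows that this word is shortest. Hence the growth series is the sum of (x/(1-x))^|G| over the
faces G (`growthSeries_eq_sum_faces`), and multiplication by (1-x)^d turns it into the sum of x^|G|
(1-x)^(d-|G|).

That this equals the h-polynomial, the sum of (x-1)^(d-|G|), is the Dehn–Sommerville symmetry
(`sum_faces_eq_sum_faces`). Perturb an interior point of the cone over each face in a generic
direction ξ: it enters the cone of exactly one facet F. The faces are thereby partitioned into
Boolean intervals [N(F), F], where N(F) is the set of vertices of F at which ξ has a negative
coordinate. Both sums then become the sum of x^|N(F)| over the facets, one computed with ξ and the
other with -ξ.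

Unimodularity is not assumed. When at most two primes p, q divide m it holds because every linear
relation among the roots is a function constant on p-cosets plus a function constant on q-cosets;
rounding one down and the other up preserves both properties and makes coefficients integral
(`exists_int_coord`). When three primes divide m, simpliciality fails
(`exists_face_not_linearIndepOn`): a p × q × r transportation tensor with too many zeros gives a
supporting functional whose face contains more roots than the rank of their span allows. For m = 1
the polytope is a point other than the origin, and the formula is computed directly. -/

/-- `G` is the set of points of the configuration `w` on a proper face of its convex hull
(when the origin is an interior point): the points at height one for a functional bounded by one. -/
def IsFace (w : ι → E) (G : Finset ι) : Prop :=
  ∃ a : E →ₗ[ℝ] ℝ, (∀ i, a (w i) ≤ 1) ∧ ∀ i, i ∈ G ↔ a (w i) = 1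

theorem exists_dual_eq_on (hG : LinearIndepOn ℝ w (G : Set ι)) (g : ι → ℝ) :
    ∃ u : E →ₗ[ℝ] ℝ, ∀ i ∈ G, u (w i) = g i := by
  obtain ⟨u, hu⟩ := LinearMap.exists_extend
    ((Module.Basis.span hG).constr ℝ (fun i : (G : Set ι) => g i))
  refine ⟨u, fun i hi => ?_⟩
  have h := (Module.Basis.span hG).constr_basis ℝ (fun i : (G : Set ι) => g i) ⟨i, hi⟩
  rw [← hu] at h
  have e : ((Module.Basis.span hG ⟨i, hi⟩ : Submodule.span ℝ _) : E) = w i :=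
    congrArg Subtype.val (Module.Basis.span_apply hG ⟨i, hi⟩)
  rw [← e]
  exact h

/-- Let a and b be the functionals of G and H. Applying a gives ∑ α ≤ ∑ β, applying b gives ∑ β ≤ ∑
α. So equality holds termwise, and positivity of α forces b = 1 on G. Used in both directions, this
says that distinct faces have cones with disjoint relative interiors; linear independence is not
needed. -/
theorem IsFace.subset_of_sum_eq (hG : IsFace w G) (hH : IsFace w H) {α β : ι → ℝ}
    (hα : ∀ i ∈ G, 0 < α i) (hβ : ∀ i ∈ H, 0 ≤ β i)
    (h : ∑ i ∈ G, α i • w i = ∑ i ∈ H, β i • w i) : G ⊆ H := by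
  obtain ⟨a, ha1, ha⟩ := hG
  obtain ⟨b, hb1, hb⟩ := hH
  have e1 : ∑ i ∈ G, α i * a (w i) = ∑ i ∈ H, β i * a (w i) := by
    simpa using congrArg a h
  have e2 : ∑ i ∈ G, α i * b (w i) = ∑ i ∈ H, β i * b (w i) := by
    simpa using congrArg b h
  have e3 : ∑ i ∈ G, α i * a (w i) = ∑ i ∈ G, α i :=
    Finset.sum_congr rfl fun i hi => by rw [(ha i).1 hi, mul_one]
  have e4 : ∑ i ∈ H, β i * b (w i) = ∑ i ∈ H, β i :=
    Finset.sum_congr rfl fun i hi => by rw [(hb i).1 hi, mul_one]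
  have e5 : ∑ i ∈ H, β i * a (w i) ≤ ∑ i ∈ H, β i :=
    Finset.sum_le_sum fun i hi => mul_le_of_le_one_right (hβ i hi) (ha1 i)
  have hle : ∀ i ∈ G, α i * b (w i) ≤ α i := fun i hi =>
    mul_le_of_le_one_right (hα i hi).le (hb1 i)
  have e6 : ∑ i ∈ G, α i * b (w i) = ∑ i ∈ G, α i :=
    le_antisymm (Finset.sum_le_sum hle) (by linarith)
  intro i hi
  have := (Finset.sum_eq_sum_iff_of_le hle).1 e6 i hi
  exact (hb i).2 (mul_left_cancel₀ (hα i hi).ne' (by rw [this, mul_one]))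

/-- A functional whose maximum over the configuration is one cuts out of the convex hull the convex
hull of the points where the maximum is attained. -/
theorem convexHull_inter_height_one {a : E →ₗ[ℝ] ℝ} (ha1 : ∀ i, a (w i) ≤ 1)
    (ha : ∀ i, i ∈ G ↔ a (w i) = 1) :
    {x ∈ convexHull ℝ (Set.range w) | a x = 1} = convexHull ℝ (w '' (G : Set ι)) := by
  apply Set.Subset.antisymm
  · rintro x ⟨hx, hax⟩
    rw [convexHull_range_eq_exists_affineCombination] at hx
    obtain ⟨s, c, hc0, hc1, rfl⟩ := hx
    rw [s.affineCombination_eq_linear_combination w c hc1] at hax ⊢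
    have e1 : ∑ i ∈ s, c i * a (w i) = ∑ i ∈ s, c i := by
      rw [hc1]; simpa using hax
    have e2 := (Finset.sum_eq_sum_iff_of_le
      fun i hi => mul_le_of_le_one_right (hc0 i hi) (ha1 i)).1 e1
    have hz : ∀ i ∈ s, c i ≠ 0 → i ∈ G := fun i hi hci =>
      (ha i).2 (mul_left_cancel₀ hci (by rw [e2 i hi, mul_one]))
    classical
    rw [← Finset.sum_filter_ne_zero]
    have : ∀ i ∈ s.filter (fun i => c i • w i ≠ 0), w i ∈ convexHull ℝ (w '' (G : Set ι)) := by
      intro i hi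
      rw [Finset.mem_filter] at hi
      exact subset_convexHull ℝ _ ⟨i, hz i hi.1 fun h => hi.2 (by simp [h]), rfl⟩
    have hsub : ∑ i ∈ s.filter (fun i => c i ≠ 0), c i • w i
        = ∑ i ∈ s.filter (fun i => c i • w i ≠ 0), c i • w i := by
      rw [Finset.sum_filter_ne_zero, Finset.sum_filter]
      exact Finset.sum_congr rfl fun i _ => by by_cases h : c i = 0 <;> simp [h]
    rw [← hsub]
    refine Convex.sum_mem (convex_convexHull ℝ _) (fun i hi => hc0 i (Finset.mem_filter.1 hi).1)
      (by rw [Finset.sum_filter_ne_zero, hc1]) fun i hi => ?_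
    rw [Finset.mem_filter] at hi
    exact subset_convexHull ℝ _ ⟨i, hz i hi.1 hi.2, rfl⟩
  · refine convexHull_min ?_ ?_
    · rintro _ ⟨i, hi, rfl⟩
      exact ⟨subset_convexHull ℝ _ ⟨i, rfl⟩, (ha i).1 hi⟩
    · exact (convex_convexHull ℝ _).inter
        ((convex_singleton (1 : ℝ)).linear_preimage a)

variable [Fintype ι]

/-- Tilt the functional of G by a small multiple of one that is 0 on H and -1 on the rest of G. The
strict inequalities off G are finitely many, so they survive. -/
theorem IsFace.subset (hG : IsFace w G) (hi : LinearIndepOn ℝ w (G : Set ι)) (hH : H ⊆ G) :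
    IsFace w H := by
  classical
  obtain ⟨a, ha1, ha⟩ := hG
  obtain ⟨u, hu⟩ := exists_dual_eq_on hi (fun i => if i ∈ H then 0 else -1)
  have hev : ∀ᶠ ε : ℝ in 𝓝[>] 0, ∀ i, i ∉ G → a (w i) + ε * u (w i) < 1 := by
    refine eventually_all.2 fun i => ?_
    by_cases hiG : i ∈ G
    · simp [hiG]
    have hlt : a (w i) < 1 := lt_of_le_of_ne (ha1 i) fun h => hiG ((ha i).2 h)
    have ht : Tendsto (fun ε : ℝ => a (w i) + ε * u (w i)) (𝓝[>] 0) (𝓝 (a (w i))) := by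
      have : Tendsto (fun ε : ℝ => a (w i) + ε * u (w i)) (𝓝 0) (𝓝 (a (w i) + 0 * u (w i))) :=
        Continuous.tendsto (by fun_prop) 0
      simpa using this.mono_left nhdsWithin_le_nhds
    filter_upwards [ht.eventually_lt_const hlt] with ε hε _ using hε
  obtain ⟨ε, hε, hpos⟩ := (hev.and self_mem_nhdsWithin).exists
  have hpos : 0 < ε := hpos
  refine ⟨a + ε • u, fun i => ?_, fun i => ?_⟩
  · by_cases hiG : i ∈ G
    · have h1 := (ha i).1 hiG
      have h2 := hu i hiG
      by_cases hiH : i ∈ H <;> simp [h1, h2, hiH, hpos.le]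
    · simpa using (hε i hiG).le
  · by_cases hiG : i ∈ G
    · have h1 := (ha i).1 hiG
      have h2 := hu i hiG
      by_cases hiH : i ∈ H <;> simp [h1, h2, hiH, hpos.ne']
    · have := (hε i hiG).ne
      simpa [this] using fun h => hiG (hH h)

/-- This is what allows a nonzero functional to be divided by its maximum over the configuration, so
that height one describes every nonempty proper face. -/
theorem exists_pos_of_sum_eq_zero (hsum : ∑ i, w i = 0)
    (hspan : Submodule.span ℝ (Set.range w) = ⊤) {a : E →ₗ[ℝ] ℝ} (ha : a ≠ 0) :
    ∃ i, 0 < a (w i) := by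
  by_contra! hcon
  have h0 : ∑ i, a (w i) = 0 := by rw [← map_sum, hsum, map_zero]
  have := (Finset.sum_eq_zero_iff_of_nonpos fun i _ => hcon i).1 h0
  refine ha (LinearMap.ext_on_range hspan fun i => ?_)
  simpa using this i (Finset.mem_univ i)

variable [FiniteDimensional ℝ E]

/-- The origin is the barycentre. If it were not interior, a separating functional would be nonzero
and nowhere positive on the points, although its values there sum to zero. -/
theorem zero_mem_interior_convexHull [Nonempty ι] (hsum : ∑ i, w i = 0)
    (hspan : Submodule.span ℝ (Set.range w) = ⊤) :
    (0 : E) ∈ interior (convexHull ℝ (Set.range w)) := by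
  have h0 : (0 : E) ∈ convexHull ℝ (Set.range w) := by
    have hc : (Fintype.card ι : ℝ) ≠ 0 := by simp
    have := Convex.sum_mem (convex_convexHull ℝ (Set.range w)) (t := Finset.univ)
      (w := fun _ : ι => (Fintype.card ι : ℝ)⁻¹) (z := w) (by intros; positivity)
      (by simp [hc]) (fun i _ => subset_convexHull ℝ _ ⟨i, rfl⟩)
    rwa [← Finset.smul_sum, hsum, smul_zero] at this
  have hne : (interior (convexHull ℝ (Set.range w))).Nonempty := by
    rw [interior_convexHull_nonempty_iff_affineSpan_eq_top, ← affineSpan_convexHull]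
    rw [← AffineSubspace.direction_eq_top_iff_of_nonempty
      ⟨0, subset_affineSpan ℝ _ h0⟩, direction_affineSpan, vectorSpan_eq_span_vsub_set_right ℝ h0,
      eq_top_iff, ← hspan]
    refine Submodule.span_mono ?_
    rintro _ ⟨i, rfl⟩
    exact ⟨w i, subset_convexHull ℝ _ ⟨i, rfl⟩, by simp⟩
  by_contra hcon
  obtain ⟨f, hf⟩ := geometric_hahn_banach_open_point
    (convex_convexHull ℝ (Set.range w)).interior isOpen_interior hcon
  have hle : ∀ x ∈ convexHull ℝ (Set.range w), f x ≤ 0 := by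
    intro x hx
    have hx' := subset_closure hx
    rw [← (convex_convexHull ℝ _).closure_interior_eq_closure_of_nonempty_interior hne] at hx'
    exact closure_minimal (t := {x | f x ≤ 0}) (fun y hy => by simpa using (hf y hy).le)
      (isClosed_le (by fun_prop) (by fun_prop)) hx'
  obtain ⟨x, hx⟩ := hne
  have hf0 : (f : E →ₗ[ℝ] ℝ) ≠ 0 := by
    intro h
    have h1 := hf x hx
    have h2 : f x = 0 := by simpa using congrArg (fun g : E →ₗ[ℝ] ℝ => g x) h
    rw [h2] at h1
    simp at h1
  obtain ⟨i, hi⟩ := exists_pos_of_sum_eq_zero hsum hspan hf0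
  exact absurd (hle (w i) (subset_convexHull ℝ _ ⟨i, rfl⟩)) (not_le.2 hi)

/-- The cones over the faces cover the space. -/
theorem exists_face_cone [Nonempty ι] (hsum : ∑ i, w i = 0)
    (hspan : Submodule.span ℝ (Set.range w) = ⊤) (y : E) :
    ∃ G : Finset ι, IsFace w G ∧ ∃ α : ι → ℝ, (∀ i, 0 ≤ α i) ∧ y = ∑ i ∈ G, α i • w i := by
  classical
  by_cases hy : y = 0
  · exact ⟨∅, ⟨0, by simp, by simp⟩, 0, by simp, by simp [hy]⟩
  set P := convexHull ℝ (Set.range w) with hP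
  have hPc : Convex ℝ P := convex_convexHull ℝ _
  have hPcomp : IsCompact P := (Set.finite_range w).isCompact_convexHull (𝕜 := ℝ)
  have h0 : (0 : E) ∈ interior P := zero_mem_interior_convexHull hsum hspan
  have hnhds : P ∈ 𝓝 (0 : E) := mem_interior_iff_mem_nhds.1 h0
  -- Dividing y by its Minkowski gauge moves it to the boundary of P, where a supporting functional
  -- f exists; f is then scaled to height one, which is possible since 0 is interior.
  have hg : 0 < gauge P y :=
    (gauge_pos (absorbent_nhds_zero hnhds)
      ((NormedSpace.isVonNBounded_iff ℝ).2 hPcomp.isBounded)).2 hy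
  set t := gauge P y
  have hfr : t⁻¹ • y ∈ frontier P := by
    rw [← gauge_eq_one_iff_mem_frontier hPc hnhds, gauge_smul_of_nonneg (by positivity)]
    simp [t, hg.ne']
  have hyP : t⁻¹ • y ∈ P := hPcomp.isClosed.frontier_subset hfr
  obtain ⟨f, hf⟩ := geometric_hahn_banach_open_point hPc.interior isOpen_interior hfr.2
  set M := f (t⁻¹ • y) with hM
  have hMpos : 0 < M := by simpa using hf 0 h0
  have hle : ∀ x ∈ P, f x ≤ M := by
    intro x hx
    have hx' := subset_closure hx
    rw [← hPc.closure_interior_eq_closure_of_nonempty_interior ⟨0, h0⟩] at hx'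
    exact closure_minimal (t := {x | f x ≤ M}) (fun y hy => (hf y hy).le)
      (isClosed_le (by fun_prop) (by fun_prop)) hx'
  set a : E →ₗ[ℝ] ℝ := M⁻¹ • (f : E →ₗ[ℝ] ℝ) with ha
  have ha1 : ∀ i, a (w i) ≤ 1 := fun i => by
    have := hle (w i) (subset_convexHull ℝ _ ⟨i, rfl⟩)
    simp only [ha, LinearMap.smul_apply, smul_eq_mul, ContinuousLinearMap.coe_coe]
    rw [inv_mul_le_iff₀ hMpos]
    simpa using this
  set G : Finset ι := Finset.univ.filter fun i => a (w i) = 1 with hG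
  have hGa : ∀ i, i ∈ G ↔ a (w i) = 1 := by simp [hG]
  refine ⟨G, ⟨a, ha1, hGa⟩, ?_⟩
  have hmem : t⁻¹ • y ∈ convexHull ℝ (w '' (G : Set ι)) := by
    rw [← convexHull_inter_height_one ha1 hGa]
    refine ⟨hyP, ?_⟩
    simp only [ha, LinearMap.smul_apply, smul_eq_mul, ContinuousLinearMap.coe_coe]
    rw [← hM, inv_mul_cancel₀ hMpos.ne']
  rw [Set.image_eq_range, convexHull_range_eq_exists_affineCombination] at hmem
  obtain ⟨s, c, hc0, hc1, hcy⟩ := hmem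
  rw [s.affineCombination_eq_linear_combination _ c hc1] at hcy
  refine ⟨fun i => if h : i ∈ G then (if (⟨i, h⟩ : (G : Set ι)) ∈ s then t * c ⟨i, h⟩ else 0)
    else 0, fun i => ?_, ?_⟩
  · dsimp only
    split_ifs with h1 h2
    · exact mul_nonneg hg.le (hc0 _ h2)
    · exact le_rfl
    · exact le_rfl
  · have : y = t • ∑ i ∈ s, c i • w i := by rw [hcy, smul_inv_smul₀ hg.ne']
    rw [this, ← Finset.sum_coe_sort G, Finset.smul_sum]
    simp only [Finset.coe_mem, dite_true, Subtype.coe_eta]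
    simp only [ite_smul, zero_smul, mul_smul]
    symm
    exact (Finset.sum_ite_mem Finset.univ s _).trans (by rw [Finset.univ_inter])

end Configuration

/-! ### The `h`-vector of a simplicial fan by generic perturbation -/

section Perturbation

variable {ι E : Type*} [NormedAddCommGroup E] [NormedSpace ℝ E]
  {w : ι → E} {ξ : E} {F G H : Finset ι}

open Filter Topology

/-- A vector outside all proper subspaces spanned by points of the configuration. -/
def IsGeneric (w : ι → E) (ξ : E) : Prop :=
  ∀ G : Finset ι, Submodule.span ℝ (w '' (G : Set ι)) ≠ ⊤ →
    ξ ∉ Submodule.span ℝ (w '' (G : Set ι))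

/-- A real vector space is not a union of finitely many proper subspaces. -/
theorem exists_isGeneric [Finite ι] (w : ι → E) : ∃ ξ, IsGeneric w ξ := by
  obtain ⟨ξ, hξ⟩ := Submodule.exists_forall_notMem_of_forall_ne_top (K := ℝ)
    (fun G : {G : Finset ι // Submodule.span ℝ (w '' (G : Set ι)) ≠ ⊤} =>
      Submodule.span ℝ (w '' (G.1 : Set ι))) (fun G => G.2)
  exact ⟨ξ, fun G hG => hξ ⟨G, hG⟩⟩

theorem IsGeneric.neg (h : IsGeneric w ξ) : IsGeneric w (-ξ) := fun G hG hm =>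
  h G hG (by simpa using hm)

/-- A face with as many points as the dimension. -/
def IsFacet (w : ι → E) (F : Finset ι) : Prop :=
  IsFace w F ∧ F.card = Module.finrank ℝ E

open Classical in
/-- The coordinates of a vector with respect to the points of a facet. -/
def facetCoord (w : ι → E) (F : Finset ι) (ξ : E) : ι → ℝ :=
  if h : ∃ c : ι → ℝ, ξ = ∑ i ∈ F, c i • w i then h.choose else 0

open Classical in
/-- The points of a facet at which a vector has a negative coordinate. -/
def negPart (w : ι → E) (ξ : E) (F : Finset ι) : Finset ι :=
  F.filter fun i => facetCoord w F ξ i < 0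

theorem exists_sum_of_mem_span {y : E} (h : y ∈ Submodule.span ℝ (w '' (G : Set ι))) :
    ∃ c : ι → ℝ, y = ∑ i ∈ G, c i • w i := by
  obtain ⟨c, hc⟩ := (Submodule.mem_span_image_finset_iff_exists_fun ℝ).1 h
  classical
  refine ⟨fun i => if h : i ∈ G then c ⟨i, h⟩ else 0, ?_⟩
  rw [← hc, ← Finset.sum_coe_sort G]
  simp

theorem sum_mem_span (c : ι → ℝ) :
    ∑ i ∈ G, c i • w i ∈ Submodule.span ℝ (w '' (G : Set ι)) :=
  Submodule.sum_mem _ fun i hi =>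
    Submodule.smul_mem _ _ (Submodule.subset_span ⟨i, hi, rfl⟩)

theorem eq_on_of_sum_eq (hG : LinearIndepOn ℝ w (G : Set ι)) {c c' : ι → ℝ}
    (h : ∑ i ∈ G, c i • w i = ∑ i ∈ G, c' i • w i) : ∀ i ∈ G, c i = c' i := by
  intro i hi
  have := linearIndepOn_finset_iff.1 hG (fun i => c i - c' i)
    (by simp only [sub_smul, Finset.sum_sub_distrib, h, sub_self]) i hi
  linarith

theorem negPart_subset : negPart w ξ F ⊆ F := Finset.filter_subset _ _

theorem sum_indicator_smul [DecidableEq ι] (hGF : G ⊆ F) :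
    ∑ i ∈ G, w i = ∑ i ∈ F, (if i ∈ G then (1 : ℝ) else 0) • w i := by
  simp only [ite_smul, one_smul, zero_smul]
  rw [Finset.sum_ite_mem, Finset.inter_eq_right.2 hGF]

variable [FiniteDimensional ℝ E]

theorem span_image_eq_top_iff (hG : LinearIndepOn ℝ w (G : Set ι)) :
    Submodule.span ℝ (w '' (G : Set ι)) = ⊤ ↔ G.card = Module.finrank ℝ E := by
  have : Module.finrank ℝ (Submodule.span ℝ (w '' (G : Set ι))) = G.card := by
    have := finrank_span_eq_card (R := ℝ) hG
    rw [Set.image_eq_range]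
    simpa using this
  rw [← this]
  exact ⟨fun h => by rw [h, finrank_top], Submodule.eq_top_of_finrank_eq⟩

theorem facetCoord_spec (hF : LinearIndepOn ℝ w (F : Set ι))
    (hc : F.card = Module.finrank ℝ E) (ξ : E) : ξ = ∑ i ∈ F, facetCoord w F ξ i • w i := by
  have h : ∃ c : ι → ℝ, ξ = ∑ i ∈ F, c i • w i :=
    exists_sum_of_mem_span (by rw [(span_image_eq_top_iff hF).2 hc]; trivial)
  rw [facetCoord, dif_pos h]
  exact h.choose_spec

theorem facetCoord_neg (hF : LinearIndepOn ℝ w (F : Set ι))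
    (hc : F.card = Module.finrank ℝ E) {i : ι} (hi : i ∈ F) :
    facetCoord w F (-ξ) i = -facetCoord w F ξ i := by
  refine eq_on_of_sum_eq hF (c' := fun i => -facetCoord w F ξ i) ?_ i hi
  rw [← facetCoord_spec hF hc (-ξ)]
  simp only [neg_smul, Finset.sum_neg_distrib]
  rw [← facetCoord_spec hF hc ξ]

/-- A vanishing coordinate would put ξ into the span of fewer points than the dimension. -/
theorem facetCoord_ne_zero (hξ : IsGeneric w ξ) (hF : LinearIndepOn ℝ w (F : Set ι))
    (hc : F.card = Module.finrank ℝ E) {i : ι} (hi : i ∈ F) : facetCoord w F ξ i ≠ 0 := by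
  classical
  intro h0
  have hind : LinearIndepOn ℝ w ((F.erase i : Finset ι) : Set ι) :=
    hF.mono (by exact_mod_cast Finset.erase_subset i F)
  refine hξ (F.erase i) ?_ ?_
  · rw [Ne, span_image_eq_top_iff hind, ← hc]
    exact (Finset.card_erase_lt_of_mem hi).ne
  · rw [facetCoord_spec hF hc ξ, ← Finset.add_sum_erase _ _ hi, h0, zero_smul, zero_add]
    exact sum_mem_span _

theorem card_negPart_neg (hξ : IsGeneric w ξ) (hF : LinearIndepOn ℝ w (F : Set ι))
    (hc : F.card = Module.finrank ℝ E) :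
    (negPart w (-ξ) F).card = F.card - (negPart w ξ F).card := by
  classical
  have : negPart w (-ξ) F = F \ negPart w ξ F := by
    ext i
    simp only [negPart, Finset.mem_filter, Finset.mem_sdiff]
    refine and_congr_right fun hi => ?_
    rw [facetCoord_neg hF hc hi]
    have := facetCoord_ne_zero hξ hF hc hi
    simp only [hi, true_and, neg_neg_iff_pos, not_lt]
    exact ⟨le_of_lt, fun h => lt_of_le_of_ne h this.symm⟩
  rw [this, Finset.card_sdiff_of_subset negPart_subset]

/-- For G ⊆ F these are the coordinates with respect to F of the perturbed point ∑ i ∈ G, w i + ε ξ.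
The condition on the negative part is what puts this point inside the open cone of F for small ε. -/
theorem eventually_pos_facetCoord [DecidableEq ι] (hξ : IsGeneric w ξ)
    (hF : LinearIndepOn ℝ w (F : Set ι)) (hc : F.card = Module.finrank ℝ E)
    (hn : negPart w ξ F ⊆ G) :
    ∀ᶠ ε : ℝ in 𝓝[>] 0, ∀ i ∈ F, 0 < (if i ∈ G then (1 : ℝ) else 0) + ε * facetCoord w F ξ i := by
  refine (Filter.eventually_all_finset F).2 fun i hi => ?_
  by_cases hiG : i ∈ G
  · have ht : Tendsto (fun ε : ℝ => 1 + ε * facetCoord w F ξ i) (𝓝[>] 0) (𝓝 1) := by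
      have : Tendsto (fun ε : ℝ => 1 + ε * facetCoord w F ξ i) (𝓝 0)
          (𝓝 (1 + 0 * facetCoord w F ξ i)) := Continuous.tendsto (by fun_prop) 0
      simpa using this.mono_left nhdsWithin_le_nhds
    simpa [hiG] using ht.eventually_const_lt one_pos
  · have h1 := facetCoord_ne_zero hξ hF hc hi
    have h2 : 0 < facetCoord w F ξ i := by
      refine lt_of_le_of_ne (not_lt.1 fun h => hiG (hn ?_)) h1.symm
      exact Finset.mem_filter.2 ⟨hi, h⟩
    filter_upwards [self_mem_nhdsWithin] with ε hε
    simpa [hiG] using mul_pos hε h2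

/-- Two facets that contain the perturbed face coincide. -/
theorem facet_eq_of_negPart_subset (hind : ∀ G, IsFace w G → LinearIndepOn ℝ w (G : Set ι))
    (hξ : IsGeneric w ξ) (hF : IsFacet w F) (hH : IsFacet w H)
    (hnF : negPart w ξ F ⊆ G) (hGF : G ⊆ F) (hnH : negPart w ξ H ⊆ G) (hGH : G ⊆ H) : F = H := by
  classical
  obtain ⟨ε, h1, h2⟩ := ((eventually_pos_facetCoord hξ (hind F hF.1) hF.2 hnF).and
    (eventually_pos_facetCoord hξ (hind H hH.1) hH.2 hnH)).exists
  have key : ∀ K : Finset ι, IsFacet w K → G ⊆ K →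
      ∑ i ∈ K, ((if i ∈ G then (1 : ℝ) else 0) + ε * facetCoord w K ξ i) • w i
        = ∑ i ∈ G, w i + ε • ξ := by
    intro K hK hGK
    conv_rhs => rw [facetCoord_spec (hind K hK.1) hK.2 ξ, sum_indicator_smul hGK]
    simp only [add_smul, Finset.sum_add_distrib, mul_smul, Finset.smul_sum]
  have e := (key F hF hGF).trans (key H hH hGH).symm
  exact (hF.1.subset_of_sum_eq hH.1 h1 (fun i hi => (h2 i hi).le) e).antisymm
    (hH.1.subset_of_sum_eq hF.1 h2 (fun i hi => (h1 i hi).le) e.symm)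

variable [Fintype ι]

/-- The perturbed point ∑ i ∈ G, w i + ε ξ lies in the cone of one fixed face F for arbitrarily
small ε. Genericity makes F a facet, the limit ε → 0 gives G ⊆ F, and outside G the coordinates are
ε times those of ξ, which gives the other inclusion. -/
theorem exists_facet_of_face [Nonempty ι] (hsum : ∑ i, w i = 0)
    (hspan : Submodule.span ℝ (Set.range w) = ⊤)
    (hind : ∀ G, IsFace w G → LinearIndepOn ℝ w (G : Set ι))
    (hξ : IsGeneric w ξ) (hG : IsFace w G) :
    ∃ F, IsFacet w F ∧ negPart w ξ F ⊆ G ∧ G ⊆ F := by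
  classical
  -- Pigeonhole: the cones cover the space and there are finitely many, so one of them recurs as ε →
  -- 0.
  have hfreq : ∃ F : Finset ι, ∃ᶠ ε : ℝ in 𝓝[>] 0, IsFace w F ∧ ∃ α : ι → ℝ, (∀ i, 0 ≤ α i) ∧
      ∑ i ∈ G, w i + ε • ξ = ∑ i ∈ F, α i • w i := by
    by_contra hcon
    simp only [not_exists, not_frequently] at hcon
    obtain ⟨ε, hε⟩ := (eventually_all.2 hcon).exists
    obtain ⟨F, hF, α, hα, h⟩ := exists_face_cone hsum hspan (∑ i ∈ G, w i + ε • ξ)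
    exact hε F ⟨hF, α, hα, h⟩
  obtain ⟨F, hF⟩ := hfreq
  have hFface : IsFace w F := hF.exists.choose_spec.1
  have hFind := hind F hFface
  have hcard : F.card = Module.finrank ℝ E := by
    rw [← span_image_eq_top_iff hFind]
    by_contra hne
    -- Subtracting the points for two different ε leaves a nonzero multiple of ξ in the span of F,
    -- so this span cannot be proper.
    obtain ⟨ε₁, ⟨-, α₁, -, h₁⟩, hε₁⟩ := (hF.and_eventually self_mem_nhdsWithin).exists
    have hε₁ : 0 < ε₁ := hε₁
    obtain ⟨ε₂, ⟨-, α₂, -, h₂⟩, hε₂⟩ := (hF.and_eventually (Ioo_mem_nhdsGT hε₁)).exists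
    refine hξ F hne ?_
    have hm : (ε₁ - ε₂) • ξ ∈ Submodule.span ℝ (w '' (F : Set ι)) := by
      have : (ε₁ - ε₂) • ξ = ∑ i ∈ F, α₁ i • w i - ∑ i ∈ F, α₂ i • w i := by
        rw [← h₁, ← h₂, sub_smul]; abel
      rw [this]
      exact Submodule.sub_mem _ (sum_mem_span _) (sum_mem_span _)
    have hne' : ε₁ - ε₂ ≠ 0 := (sub_pos.2 hε₂.2).ne'
    simpa [smul_smul, hne'] using Submodule.smul_mem _ (ε₁ - ε₂)⁻¹ hm
  obtain ⟨γ, hγ⟩ : ∃ c : ι → ℝ, ∑ i ∈ G, w i = ∑ i ∈ F, c i • w i :=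
    ⟨_, facetCoord_spec hFind hcard _⟩
  have hcoord : ∃ᶠ ε : ℝ in 𝓝[>] 0, ∀ i ∈ F, 0 ≤ γ i + ε * facetCoord w F ξ i := by
    refine hF.mono ?_
    rintro ε ⟨-, α, hα, h⟩ i hi
    have : γ i + ε * facetCoord w F ξ i = α i := by
      refine eq_on_of_sum_eq hFind (c := fun i => γ i + ε * facetCoord w F ξ i) ?_ i hi
      rw [← h, hγ]
      conv_rhs => rw [facetCoord_spec hFind hcard ξ]
      simp only [add_smul, Finset.sum_add_distrib, mul_smul, Finset.smul_sum]
    rw [this]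
    exact hα i
  have hγ0 : ∀ i ∈ F, 0 ≤ γ i := by
    intro i hi
    by_contra! hneg
    have ht : Tendsto (fun ε : ℝ => γ i + ε * facetCoord w F ξ i) (𝓝[>] 0) (𝓝 (γ i)) := by
      have : Tendsto (fun ε : ℝ => γ i + ε * facetCoord w F ξ i) (𝓝 0)
          (𝓝 (γ i + 0 * facetCoord w F ξ i)) := Continuous.tendsto (by fun_prop) 0
      simpa using this.mono_left nhdsWithin_le_nhds
    obtain ⟨ε, h1, h2⟩ := (hcoord.and_eventually (ht.eventually_lt_const hneg)).exists
    exact absurd (h1 i hi) (not_le.2 h2)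
  have hGF : G ⊆ F := hG.subset_of_sum_eq hFface (α := fun _ => 1) (β := γ) (by simp) hγ0
    (by simpa using hγ)
  refine ⟨F, ⟨hFface, hcard⟩, ?_, hGF⟩
  intro i hi
  obtain ⟨hiF, hneg⟩ := Finset.mem_filter.1 hi
  by_contra hiG
  have hγi : γ i = 0 := by
    have := eq_on_of_sum_eq hFind (hγ.symm.trans (sum_indicator_smul hGF)) i hiF
    simpa [hiG] using this
  obtain ⟨ε, h1, hε⟩ := (hcoord.and_eventually self_mem_nhdsWithin).exists
  have hε : 0 < ε := hε
  have := h1 i hiF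
  rw [hγi] at this
  nlinarith

end Perturbation

/-- Writing G as A together with a subset of F \ A reduces the sum to the binomial theorem. -/
theorem sum_Icc_pow_mul_pow {ι R : Type*} [DecidableEq ι] [CommSemiring R] {A F : Finset ι}
    (h : A ⊆ F) (x y : R) :
    ∑ G ∈ Finset.Icc A F, x ^ G.card * y ^ (F.card - G.card)
      = x ^ A.card * (x + y) ^ (F.card - A.card) := by
  have hdis : ∀ G ∈ (F \ A).powerset, Disjoint A G := fun G hG =>
    (Finset.disjoint_sdiff (s := A) (t := F)).mono_right (Finset.mem_powerset.1 hG)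
  rw [Finset.Icc_eq_image_powerset h, Finset.sum_image, ← Finset.card_sdiff_of_subset h,
    ← Finset.sum_pow_mul_eq_add_pow, Finset.mul_sum]
  · refine Finset.sum_congr rfl fun G hG => ?_
    rw [Finset.card_union_of_disjoint (hdis G hG), pow_add, mul_assoc,
      Finset.card_sdiff_of_subset h, Nat.sub_sub]
  · intro G hG K hK hGK
    have := congrArg (fun S => S \ A) hGK
    simpa [Finset.union_sdiff_distrib, Finset.sdiff_eq_self_of_disjoint (hdis G hG).symm,
      Finset.sdiff_eq_self_of_disjoint (hdis K hK).symm] using this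

/-! ### Partition of the faces into Boolean intervals, and the Dehn–Sommerville relations -/

section Polynomial

variable {ι E : Type*} [Fintype ι] [NormedAddCommGroup E] [NormedSpace ℝ E]
  {w : ι → E} {ξ : E}

open Classical in
/-- The finite set of faces of a configuration. -/
def faces (w : ι → E) : Finset (Finset ι) := Finset.univ.filter (IsFace w)

theorem mem_faces {G : Finset ι} : G ∈ faces w ↔ IsFace w G := by simp [faces]

open Classical in
/-- The finite set of facets of a configuration. -/
def facets (w : ι → E) : Finset (Finset ι) := Finset.univ.filter (IsFacet w)

theorem mem_facets {G : Finset ι} : G ∈ facets w ↔ IsFacet w G := by simp [facets]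

variable [FiniteDimensional ℝ E] [Nonempty ι]

/-- Every face lies in the interval from `negPart w ξ F` to F for exactly one facet F, and every set
in such an interval is a face. Exchange the order of summation and sum each interval by the binomial
theorem. -/
theorem sum_faces_eq_sum_facets {R : Type*} [CommSemiring R] (hsum : ∑ i, w i = 0)
    (hspan : Submodule.span ℝ (Set.range w) = ⊤)
    (hind : ∀ G, IsFace w G → LinearIndepOn ℝ w (G : Set ι))
    (hξ : IsGeneric w ξ) (x y : R) :
    ∑ G ∈ faces w, x ^ G.card * y ^ (Module.finrank ℝ E - G.card)
      = ∑ F ∈ facets w, x ^ (negPart w ξ F).card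
          * (x + y) ^ (Module.finrank ℝ E - (negPart w ξ F).card) := by
  classical
  have h1 : ∀ F ∈ facets w, x ^ (negPart w ξ F).card
      * (x + y) ^ (Module.finrank ℝ E - (negPart w ξ F).card)
      = ∑ G ∈ Finset.Icc (negPart w ξ F) F, x ^ G.card * y ^ (Module.finrank ℝ E - G.card) := by
    intro F hF
    rw [← (mem_facets.1 hF).2, sum_Icc_pow_mul_pow negPart_subset]
  rw [Finset.sum_congr rfl h1]
  rw [Finset.sum_comm' (t' := faces w)
    (s' := fun G => (facets w).filter fun F => G ∈ Finset.Icc (negPart w ξ F) F)]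
  · refine Finset.sum_congr rfl fun G hG => ?_
    obtain ⟨F, hF, hn, hGF⟩ := exists_facet_of_face hsum hspan hind hξ (mem_faces.1 hG)
    have : (facets w).filter (fun F => G ∈ Finset.Icc (negPart w ξ F) F) = {F} := by
      ext H
      simp only [Finset.mem_filter, mem_facets, Finset.mem_Icc,
        Finset.mem_singleton]
      constructor
      · rintro ⟨hH, hn', hGH⟩
        exact facet_eq_of_negPart_subset hind hξ hH hF hn' hGH hn hGF
      · rintro rfl
        exact ⟨hF, hn, hGF⟩
    rw [this, Finset.sum_singleton]
  · intro F G
    simp only [Finset.mem_filter, Finset.mem_Icc, mem_faces, mem_facets]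
    constructor
    · rintro ⟨hF, hn, hGF⟩
      exact ⟨⟨hF, hn, hGF⟩, hF.1.subset (hind F hF.1) hGF⟩
    · rintro ⟨⟨hF, hn, hGF⟩, -⟩
      exact ⟨hF, hn, hGF⟩

/-- The Dehn–Sommerville relations, in the form in which the growth series produces the
`h`-polynomial. -/
theorem sum_faces_eq_sum_faces (hsum : ∑ i, w i = 0)
    (hspan : Submodule.span ℝ (Set.range w) = ⊤)
    (hind : ∀ G, IsFace w G → LinearIndepOn ℝ w (G : Set ι)) :
    ∑ G ∈ faces w, (Polynomial.X : ℤ[X]) ^ G.card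
        * (1 - Polynomial.X) ^ (Module.finrank ℝ E - G.card)
      = ∑ G ∈ faces w, (Polynomial.X - 1) ^ (Module.finrank ℝ E - G.card) := by
  obtain ⟨ξ, hξ⟩ := exists_isGeneric w
  -- With (x, y) = (1, X - 1) and direction -ξ, a facet contributes X to the number of its
  -- nonnegative coordinates for -ξ. With (X, 1 - X) and ξ it contributes X to the number of its
  -- negative coordinates for ξ. The exponents agree.
  have h2 := sum_faces_eq_sum_facets hsum hspan hind hξ.neg (1 : ℤ[X]) (Polynomial.X - 1)
  simp only [one_pow, one_mul] at h2
  rw [h2, sum_faces_eq_sum_facets hsum hspan hind hξ]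
  refine Finset.sum_congr rfl fun F hF => ?_
  have hF' := mem_facets.1 hF
  have hle : (negPart w ξ F).card ≤ F.card := Finset.card_le_card negPart_subset
  rw [card_negPart_neg hξ (hind F hF'.1) hF'.2, ← hF'.2, Nat.sub_sub_self hle]
  simp

end Polynomial

/-! ### Faces of a simplicial polytope as faces of a configuration -/

section Polytope

variable {ι E : Type*} [NormedAddCommGroup E] [NormedSpace ℝ E]
  {w : ι → E} {G H : Finset ι}

theorem mem_of_mem_convexHull {a : E →ₗ[ℝ] ℝ} (ha1 : ∀ i, a (w i) ≤ 1)
    (ha : ∀ i, i ∈ G ↔ a (w i) = 1) {i : ι} (hi : w i ∈ convexHull ℝ (w '' (G : Set ι))) :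
    i ∈ G := by
  rw [← convexHull_inter_height_one ha1 ha] at hi
  exact (ha i).2 hi.2

/-- An exposing functional of a nonempty proper face is nonzero, so its maximum is positive and can
be scaled to one. The empty face is given by the zero functional and G = ∅. -/
theorem exists_face_of_isExposed [Fintype ι] (hsum : ∑ i, w i = 0)
    (hspan : Submodule.span ℝ (Set.range w) = ⊤) {F : Set E}
    (hF : IsExposed ℝ (convexHull ℝ (Set.range w)) F) (hne : F ≠ convexHull ℝ (Set.range w)) :
    ∃ G, IsFace w G ∧ F = convexHull ℝ (w '' (G : Set ι)) := by
  classical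
  by_cases hF0 : F = ∅
  · exact ⟨∅, ⟨0, by simp, by simp⟩, by simp [hF0]⟩
  obtain ⟨x₀, hx₀⟩ := Set.nonempty_iff_ne_empty.2 hF0
  obtain ⟨l, hl⟩ := hF ⟨x₀, hx₀⟩
  have hl0 : (l : E →ₗ[ℝ] ℝ) ≠ 0 := by
    intro h
    refine hne ?_
    have hz : ∀ x, l x = 0 := fun x => by simpa using congrArg (fun g : E →ₗ[ℝ] ℝ => g x) h
    rw [hl]
    ext x
    simp [hz]
  rw [hl] at hx₀
  set M := l x₀
  have hle : ∀ i, l (w i) ≤ M := fun i => hx₀.2 _ (subset_convexHull ℝ _ ⟨i, rfl⟩)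
  obtain ⟨i, hi⟩ := exists_pos_of_sum_eq_zero hsum hspan hl0
  have hM : 0 < M := lt_of_lt_of_le hi (hle i)
  set a : E →ₗ[ℝ] ℝ := M⁻¹ • (l : E →ₗ[ℝ] ℝ) with ha
  have hax : ∀ x, a x = M⁻¹ * l x := fun x => by simp [ha]
  have ha1 : ∀ i, a (w i) ≤ 1 := fun i => by
    rw [hax, inv_mul_le_iff₀ hM]
    simpa using hle i
  have hGa : ∀ i, i ∈ Finset.univ.filter (fun i => a (w i) = 1) ↔ a (w i) = 1 := by simp
  refine ⟨_, ⟨a, ha1, hGa⟩, ?_⟩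
  rw [← convexHull_inter_height_one ha1 hGa, hl]
  ext x
  simp only [Set.mem_ofPred_eq]
  refine and_congr_right fun hx => ?_
  rw [hax, inv_mul_eq_one₀ hM.ne']
  exact ⟨fun h => (h x₀ hx₀.1).antisymm (hx₀.2 x hx), fun h y hy => h ▸ hx₀.2 y hy⟩

theorem affineDim_convexHull_face (hG : LinearIndepOn ℝ w (G : Set ι)) :
    affineDim (convexHull ℝ (w '' (G : Set ι))) = (G.card : ℤ) - 1 := by
  unfold affineDim
  by_cases h : G = ∅
  · simp [h]
  have hpos := Finset.card_pos.2 (Finset.nonempty_iff_ne_empty.2 h)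
  rw [if_neg (by simpa using h), ← direction_affineSpan, affineSpan_convexHull,
    direction_affineSpan, Set.image_eq_range]
  have haff : AffineIndependent ℝ (fun i : (G : Set ι) => w i) :=
    LinearIndependent.affineIndependent ℝ hG
  rw [AffineIndependent.finrank_vectorSpan haff (n := G.card - 1)
    (by simp only [SetLike.coe_sort_coe, Fintype.card_coe]; omega)]
  omega

variable [FiniteDimensional ℝ E]

theorem isExposed_of_height_one {a : E →ₗ[ℝ] ℝ} (ha1 : ∀ i, a (w i) ≤ 1)
    (ha : ∀ i, i ∈ G ↔ a (w i) = 1) :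
    IsExposed ℝ (convexHull ℝ (Set.range w)) (convexHull ℝ (w '' (G : Set ι))) := by
  intro hne
  obtain ⟨_, i, hi, rfl⟩ := convexHull_nonempty_iff.1 hne
  refine ⟨LinearMap.toContinuousLinearMap a, ?_⟩
  have hle : ∀ x ∈ convexHull ℝ (Set.range w), a x ≤ 1 := by
    refine convexHull_min (t := {x | a x ≤ 1}) ?_ (convex_halfSpace_le a.isLinear 1)
    rintro _ ⟨i, rfl⟩
    exact ha1 i
  rw [← convexHull_inter_height_one ha1 ha]
  ext x
  simp only [Set.mem_ofPred_eq, LinearMap.coe_toContinuousLinearMap']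
  refine and_congr_right fun hx => ⟨fun h y hy => h ▸ hle y hy, fun h => ?_⟩
  exact (hle x hx).antisymm ((ha i).1 hi ▸ h (w i) (subset_convexHull ℝ _ ⟨i, rfl⟩))

/-- By `hvert` each w i is an extreme point, so the points of a face are among the vertices of the
simplex that the face is, and hence affinely independent. The functional equal to one on the face
turns a linear relation into an affine one, since it forces the coefficients to sum to zero. -/
theorem linearIndepOn_of_isSimplicial
    (hvert : ∀ i, ∃ a : E →ₗ[ℝ] ℝ, a (w i) = 1 ∧ ∀ j, j ≠ i → a (w j) < 1)
    (h0 : (0 : E) ∈ convexHull ℝ (Set.range w))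
    (hsimp : IsSimplicial (convexHull ℝ (Set.range w))) (hG : IsFace w G) :
    LinearIndepOn ℝ w (G : Set ι) := by
  have hext : ∀ i, w i ∈ (convexHull ℝ (Set.range w)).extremePoints ℝ := by
    intro i
    obtain ⟨a, ha, ha'⟩ := hvert i
    have := isExposed_of_height_one (w := w) (G := {i}) (a := a)
      (fun j => by by_cases h : j = i; exacts [h ▸ ha.le, (ha' j h).le])
      (fun j => by by_cases h : j = i; exacts [by simp [h, ha], by simp [h, (ha' j h).ne]])
    refine exposedPoints_subset_extremePoints (mem_exposedPoints_iff_exposed_singleton.2 ?_)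
    simpa using this
  have hinj : Function.Injective w := by
    intro i j hij
    by_contra hne
    obtain ⟨a, ha, ha'⟩ := hvert i
    exact (ha' j (Ne.symm hne)).ne (hij ▸ ha)
  obtain ⟨a, ha1, ha⟩ := hG
  have hne : convexHull ℝ (w '' (G : Set ι)) ≠ convexHull ℝ (Set.range w) := by
    rw [← convexHull_inter_height_one ha1 ha]
    intro h
    rw [← h] at h0
    simpa using h0.2
  obtain ⟨s, hs, hs'⟩ := hsimp _ (isExposed_of_height_one ha1 ha) hne
  have hmem : ∀ i : (G : Set ι), w i ∈ s := by
    intro i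
    have h1 : w i ∈ (convexHull ℝ (w '' (G : Set ι))).extremePoints ℝ :=
      inter_extremePoints_subset_extremePoints_of_subset
        (convexHull_mono (Set.image_subset_range _ _))
        ⟨subset_convexHull ℝ _ ⟨i, i.2, rfl⟩, hext i⟩
    rw [hs'] at h1
    exact extremePoints_convexHull_subset h1
  have haff : AffineIndependent ℝ (fun i : (G : Set ι) => w i) :=
    hs.comp_embedding (⟨fun i => ⟨w i, hmem i⟩, fun i j hij =>
      Subtype.ext (hinj (congrArg Subtype.val hij))⟩ : (G : Set ι) ↪ s)
  refine linearIndependent_iff'.2 fun t c hc => affineIndependent_iff.1 haff t c ?_ hc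
  have := congrArg a hc
  simp only [map_sum, map_smul, smul_eq_mul, map_zero] at this
  rw [← this]
  exact Finset.sum_congr rfl fun i _ => by rw [(ha i).1 i.2, mul_one]

variable [Fintype ι]

theorem card_le_finrank_of_face (hind : ∀ G, IsFace w G → LinearIndepOn ℝ w (G : Set ι))
    (hG : G ∈ faces w) : G.card ≤ Module.finrank ℝ E := by
  simpa using LinearIndependent.fintype_card_le_finrank (hind G (mem_faces.1 hG))

variable [Nonempty ι]

theorem affineDim_convexHull_range (hsum : ∑ i, w i = 0)
    (hspan : Submodule.span ℝ (Set.range w) = ⊤) :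
    affineDim (convexHull ℝ (Set.range w)) = Module.finrank ℝ E := by
  have h0 := zero_mem_interior_convexHull hsum hspan
  unfold affineDim
  rw [if_neg (Set.Nonempty.ne_empty ⟨0, interior_subset h0⟩), ← direction_affineSpan,
    affineSpan_eq_top_of_nonempty_interior (s := convexHull ℝ (Set.range w))
      ⟨0, by simpa using h0⟩, AffineSubspace.direction_top, finrank_top]

theorem faceNumber_eq_card (hsum : ∑ i, w i = 0)
    (hspan : Submodule.span ℝ (Set.range w) = ⊤)
    (hind : ∀ G, IsFace w G → LinearIndepOn ℝ w (G : Set ι)) {k : ℕ}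
    (hk : k ≤ Module.finrank ℝ E) :
    faceNumber (convexHull ℝ (Set.range w)) ((k : ℤ) - 1)
      = ((faces w).filter fun G => G.card = k).card := by
  rw [faceNumber, ← Fintype.card_coe, ← Nat.card_eq_fintype_card]
  symm
  refine Nat.card_congr (Equiv.ofBijective (fun G =>
    ⟨convexHull ℝ (w '' (G.1 : Set ι)), ?_, ?_⟩) ⟨?_, ?_⟩)
  · obtain ⟨a, ha1, ha⟩ := mem_faces.1 (Finset.mem_filter.1 G.2).1
    exact isExposed_of_height_one ha1 ha
  · have := Finset.mem_filter.1 G.2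
    rw [affineDim_convexHull_face (hind _ (mem_faces.1 this.1)), this.2]
  · rintro ⟨G, hG⟩ ⟨H, hH⟩ h
    have h : convexHull ℝ (w '' (G : Set ι)) = convexHull ℝ (w '' (H : Set ι)) :=
      congrArg Subtype.val h
    obtain ⟨a, ha1, ha⟩ := mem_faces.1 (Finset.mem_filter.1 hG).1
    obtain ⟨b, hb1, hb⟩ := mem_faces.1 (Finset.mem_filter.1 hH).1
    refine Subtype.ext (Finset.Subset.antisymm (fun i hi => ?_) fun i hi => ?_)
    · exact mem_of_mem_convexHull hb1 hb (h ▸ subset_convexHull ℝ _ ⟨i, hi, rfl⟩)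
    · exact mem_of_mem_convexHull ha1 ha (h ▸ subset_convexHull ℝ _ ⟨i, hi, rfl⟩)
  · rintro ⟨F, hF, hdim⟩
    -- The whole polytope has dimension d, while here the dimension is k - 1 < d.
    have hne : F ≠ convexHull ℝ (Set.range w) := by
      rintro rfl
      rw [affineDim_convexHull_range hsum hspan] at hdim
      omega
    obtain ⟨G, hG, rfl⟩ := exists_face_of_isExposed hsum hspan hF hne
    rw [affineDim_convexHull_face (hind G hG)] at hdim
    exact ⟨⟨G, Finset.mem_filter.2 ⟨mem_faces.2 hG, by omega⟩⟩, rfl⟩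

theorem hPolynomial_eq_sum_faces (hsum : ∑ i, w i = 0)
    (hspan : Submodule.span ℝ (Set.range w) = ⊤)
    (hind : ∀ G, IsFace w G → LinearIndepOn ℝ w (G : Set ι)) :
    hPolynomial (convexHull ℝ (Set.range w))
      = ∑ G ∈ faces w, (Polynomial.X - 1) ^ (Module.finrank ℝ E - G.card) := by
  rw [hPolynomial, affineDim_convexHull_range hsum hspan, Int.toNat_natCast]
  rw [← Finset.sum_fiberwise_of_maps_to (t := Finset.range (Module.finrank ℝ E + 1))
    (g := Finset.card) fun G hG => Finset.mem_range.2
      (Nat.lt_succ_of_le (card_le_finrank_of_face hind hG))]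
  refine Finset.sum_congr rfl fun k hk => ?_
  rw [faceNumber_eq_card hsum hspan hind (Nat.lt_succ_iff.1 (Finset.mem_range.1 hk)),
    Finset.sum_congr rfl (g := fun _ => (Polynomial.X - 1 : ℤ[X]) ^ (Module.finrank ℝ E - k))
      fun G hG => by rw [(Finset.mem_filter.1 hG).2]]
  simp

end Polytope

/-! ### The growth series of a unimodular simplicial configuration -/

section Growth

variable {ι E L : Type*} [NormedAddCommGroup E] [NormedSpace ℝ E]
  [AddCommGroup L] {w : ι → E} {u : ι → L} {φ : L →+ E} {G : Finset ι}

/-- Such a functional bounds word length from below; on a combination of the points of its own face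
the bound is attained. -/
theorem map_sum_le_card {a : E →ₗ[ℝ] ℝ} (ha1 : ∀ i, a (w i) ≤ 1) (hφ : ∀ i, φ (u i) = w i)
    (s : Multiset L) (hs : ∀ y ∈ s, y ∈ Set.range u) : a (φ s.sum) ≤ s.card := by
  induction s using Multiset.induction with
  | empty => simp
  | cons y s ih =>
    obtain ⟨i, rfl⟩ := hs y (Multiset.mem_cons_self y s)
    have h1 := ih fun z hz => hs z (Multiset.mem_cons_of_mem hz)
    have h2 := ha1 i
    simp only [Multiset.sum_cons, map_add, hφ, Multiset.card_cons, Nat.cast_add, Nat.cast_one]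
    linarith

variable [Fintype ι]

theorem isSumOfTerms_sum (u : ι → L) (c : ι →₀ ℕ) :
    IsSumOfTerms (Set.range u) (∑ i, c i • u i) (∑ i, c i) := by
  refine ⟨∑ i, c i • ({u i} : Multiset L), by simp, fun y hy => ?_, ?_⟩
  · obtain ⟨i, -, hi⟩ := Multiset.mem_sum.1 hy
    have := Multiset.mem_of_mem_nsmul hi
    exact ⟨i, (Multiset.mem_singleton.1 this).symm⟩
  · have := map_sum (Multiset.sumAddMonoidHom : Multiset L →+ L)
      (fun i => c i • ({u i} : Multiset L)) Finset.univ
    rw [Multiset.coe_sumAddMonoidHom] at this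
    rw [this]
    simp only [Multiset.sum_nsmul, Multiset.sum_singleton]

theorem sum_smul_eq_sum_support (v : ι → E) (c : ι →₀ ℕ) :
    ∑ i ∈ c.support, (c i : ℝ) • v i = ∑ i, (c i : ℝ) • v i :=
  Finset.sum_subset (Finset.subset_univ _) fun i _ hi => by
    rw [Finsupp.notMem_support_iff.1 hi]; simp

theorem map_sum_nsmul (hφ : ∀ i, φ (u i) = w i) (c : ι →₀ ℕ) :
    φ (∑ i, c i • u i) = ∑ i ∈ c.support, (c i : ℝ) • w i := by
  rw [sum_smul_eq_sum_support, map_sum]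
  exact Finset.sum_congr rfl fun i _ => by rw [map_nsmul, hφ, Nat.cast_smul_eq_nsmul]

/-- A combination of the points of a face, with coefficients in `ℕ`, is a shortest word. -/
theorem hasWordLength_of_face (hφ : ∀ i, φ (u i) = w i) {c : ι →₀ ℕ}
    (hc : IsFace w c.support) :
    HasWordLength (Set.range u) (∑ i, c i • u i) (∑ i, c i) := by
  refine ⟨isSumOfTerms_sum u c, ?_⟩
  rintro k ⟨s, rfl, hs, hsum⟩
  obtain ⟨a, ha1, ha⟩ := hc
  have h1 := map_sum_le_card ha1 hφ s hs
  rw [hsum, map_sum_nsmul hφ, map_sum, Finset.sum_congr rfl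
    (g := fun i => (c i : ℝ)) fun i hi => by simp [(ha i).1 hi]] at h1
  have h2 : ∑ i ∈ c.support, (c i : ℝ) = ((∑ i, c i : ℕ) : ℝ) := by
    rw [Nat.cast_sum]
    simpa using sum_smul_eq_sum_support (fun _ : ι => (1 : ℝ)) c
  rw [h2] at h1
  exact_mod_cast h1

/-- Positive coefficients determine the support, because distinct faces have cones with disjoint
relative interiors. Linear independence on that support determines the coefficients. -/
theorem face_combination_injective
    (hind : ∀ G, IsFace w G → LinearIndepOn ℝ w (G : Set ι))
    (hφ : ∀ i, φ (u i) = w i) {c c' : ι →₀ ℕ} (hc : IsFace w c.support)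
    (hc' : IsFace w c'.support) (h : ∑ i, c i • u i = ∑ i, c' i • u i) : c = c' := by
  have h1 := congrArg φ h
  rw [map_sum_nsmul hφ, map_sum_nsmul hφ] at h1
  have hpos : ∀ c : ι →₀ ℕ, ∀ i ∈ c.support, (0 : ℝ) < c i := fun c i hi =>
    Nat.cast_pos.2 (Nat.pos_of_ne_zero (Finsupp.mem_support_iff.1 hi))
  have hs : c.support = c'.support :=
    (hc.subset_of_sum_eq hc' (hpos c) (fun i hi => (hpos c' i hi).le) h1).antisymm
      (hc'.subset_of_sum_eq hc (hpos c') (fun i hi => (hpos c i hi).le) h1.symm)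
  rw [← hs] at h1
  ext i
  by_cases hi : i ∈ c.support
  · exact_mod_cast eq_on_of_sum_eq (hind _ hc) h1 i hi
  · rw [Finsupp.notMem_support_iff.1 hi, Finsupp.notMem_support_iff.1 (hs ▸ hi)]

variable [FiniteDimensional ℝ E] [Nonempty ι]

/-- Here `hint` is unimodularity. The cone that contains φ l gives nonnegative real coefficients,
which are integers by `hint`; some may vanish, so the face is replaced by the subface on their
support. -/
theorem exists_face_combination (hsum : ∑ i, w i = 0)
    (hspan : Submodule.span ℝ (Set.range w) = ⊤)
    (hind : ∀ G, IsFace w G → LinearIndepOn ℝ w (G : Set ι))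
    (hinj : Function.Injective φ) (hφ : ∀ i, φ (u i) = w i)
    (hint : ∀ G : Finset ι, IsFace w G → ∀ (α : ι → ℝ) (l : L), φ l = ∑ i ∈ G, α i • w i →
      ∀ i ∈ G, ∃ n : ℤ, α i = n) (l : L) :
    ∃ c : ι →₀ ℕ, IsFace w c.support ∧ ∑ i, c i • u i = l := by
  classical
  obtain ⟨G, hG, α, hα, hl⟩ := exists_face_cone hsum hspan (φ l)
  have hn : ∀ i, ∃ n : ℕ, i ∈ G → α i = n := by
    intro i
    by_cases hi : i ∈ G
    · obtain ⟨n, hn⟩ := hint G hG α l hl i hi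
      have h0 : 0 ≤ n := by
        have := hα i
        rw [hn] at this
        exact_mod_cast this
      lift n to ℕ using h0
      exact ⟨n, fun _ => by exact_mod_cast hn⟩
    · exact ⟨0, fun h => absurd h hi⟩
  choose n hn using hn
  set c : ι →₀ ℕ := Finsupp.equivFunOnFinite.symm fun i => if i ∈ G then n i else 0 with hc
  have hci : ∀ i, c i = if i ∈ G then n i else 0 := fun i => rfl
  have hsub : c.support ⊆ G := by
    intro i hi
    by_contra hiG
    exact Finsupp.mem_support_iff.1 hi (by simp [hci, hiG])
  refine ⟨c, hG.subset (hind G hG) hsub, hinj ?_⟩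
  rw [map_sum_nsmul hφ, sum_smul_eq_sum_support, hl]
  simp only [hci, Nat.cast_ite, Nat.cast_zero, ite_smul, zero_smul]
  rw [Finset.sum_ite_mem, Finset.univ_inter]
  exact Finset.sum_congr rfl fun i hi => by rw [hn i hi]

theorem coordinationSequence_eq_card (hsum : ∑ i, w i = 0)
    (hspan : Submodule.span ℝ (Set.range w) = ⊤)
    (hind : ∀ G, IsFace w G → LinearIndepOn ℝ w (G : Set ι))
    (hinj : Function.Injective φ) (hφ : ∀ i, φ (u i) = w i)
    (hint : ∀ G : Finset ι, IsFace w G → ∀ (α : ι → ℝ) (l : L), φ l = ∑ i ∈ G, α i • w i →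
      ∀ i ∈ G, ∃ n : ℤ, α i = n) (N : ℕ) [DecidableEq ι] :
    coordinationSequence (Set.range u) N
      = ((Finset.finsuppAntidiag (Finset.univ : Finset ι) N).filter
          fun c => c.support ∈ faces w).card := by
  rw [coordinationSequence, ← Fintype.card_coe, ← Nat.card_eq_fintype_card]
  symm
  refine Nat.card_congr (Equiv.ofBijective (fun c => ⟨∑ i, c.1 i • u i, ?_⟩) ⟨?_, ?_⟩)
  · obtain ⟨h1, h2⟩ := Finset.mem_filter.1 c.2
    have := hasWordLength_of_face hφ (mem_faces.1 h2)
    rwa [(Finset.mem_finsuppAntidiag.1 h1).1] at this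
  · rintro ⟨c, hc⟩ ⟨c', hc'⟩ h
    exact Subtype.ext (face_combination_injective hind hφ
      (mem_faces.1 (Finset.mem_filter.1 hc).2) (mem_faces.1 (Finset.mem_filter.1 hc').2)
      (congrArg Subtype.val h))
  · rintro ⟨l, hl⟩
    obtain ⟨c, hc, rfl⟩ := exists_face_combination hsum hspan hind hinj hφ hint l
    have := (hasWordLength_of_face hφ hc).unique hl
    exact ⟨⟨c, Finset.mem_filter.2 ⟨Finset.mem_finsuppAntidiag.2 ⟨this, Finset.subset_univ _⟩,
      mem_faces.2 hc⟩⟩, rfl⟩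

/-- Lattice elements correspond to natural combinations supported exactly on a face. A face G
contributes one factor x + x² + ⋯ for each of its points. -/
theorem growthSeries_eq_sum_faces (hsum : ∑ i, w i = 0)
    (hspan : Submodule.span ℝ (Set.range w) = ⊤)
    (hind : ∀ G, IsFace w G → LinearIndepOn ℝ w (G : Set ι))
    (hinj : Function.Injective φ) (hφ : ∀ i, φ (u i) = w i)
    (hint : ∀ G : Finset ι, IsFace w G → ∀ (α : ι → ℝ) (l : L), φ l = ∑ i ∈ G, α i • w i →
      ∀ i ∈ G, ∃ n : ℤ, α i = n) :
    growthSeries (Set.range u)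
      = ∑ G ∈ faces w, (PowerSeries.mk fun n : ℕ => if n = 0 then (0 : ℤ) else 1) ^ G.card := by
  classical
  ext N
  rw [growthSeries, PowerSeries.coeff_mk,
    coordinationSequence_eq_card hsum hspan hind hinj hφ hint, map_sum]
  have key := Finset.card_eq_sum_card_fiberwise (f := fun c : ι →₀ ℕ => c.support) (t := faces w)
    (s := (Finset.finsuppAntidiag (Finset.univ : Finset ι) N).filter
      fun c => c.support ∈ faces w) fun c hc => (Finset.mem_filter.1 hc).2
  rw [key, Nat.cast_sum]
  refine Finset.sum_congr rfl fun G hG => ?_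
  rw [← Finset.prod_const, PowerSeries.coeff_prod]
  simp only [PowerSeries.coeff_mk]
  have : ∀ c : ι →₀ ℕ, (∏ i ∈ G, if c i = 0 then (0 : ℤ) else 1)
      = if G ⊆ c.support then 1 else 0 := by
    intro c
    split_ifs with h
    · exact Finset.prod_eq_one fun i hi => if_neg (Finsupp.mem_support_iff.1 (h hi))
    · obtain ⟨i, hi, hi'⟩ := Finset.not_subset.1 h
      exact Finset.prod_eq_zero hi (if_pos (Finsupp.notMem_support_iff.1 hi'))
  rw [Finset.sum_congr rfl fun c _ => this c, Finset.sum_boole]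
  congr 2
  ext c
  simp only [Finset.mem_filter, Finset.mem_finsuppAntidiag]
  constructor
  · rintro ⟨⟨⟨h1, -⟩, -⟩, rfl⟩
    refine ⟨⟨?_, subset_rfl⟩, subset_rfl⟩
    rw [← h1]
    exact Finset.sum_subset (Finset.subset_univ _) fun i _ hi => Finsupp.notMem_support_iff.1 hi
  · rintro ⟨⟨h1, h2⟩, h3⟩
    have h4 : c.support = G := h2.antisymm h3
    refine ⟨⟨⟨?_, Finset.subset_univ _⟩, h4 ▸ hG⟩, h4⟩
    rw [← h1, ← h4]
    exact (Finset.sum_subset (Finset.subset_univ _)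
      fun i _ hi => Finsupp.notMem_support_iff.1 hi).symm

theorem mk_ite_mul_one_sub_X :
    (PowerSeries.mk fun n : ℕ => if n = 0 then (0 : ℤ) else 1) * (1 - PowerSeries.X)
      = PowerSeries.X := by
  ext n
  rw [mul_sub, mul_one, map_sub]
  rcases n with _ | n
  · simp
  · rw [PowerSeries.coeff_succ_mul_X, PowerSeries.coeff_mk, PowerSeries.coeff_mk,
      PowerSeries.coeff_X]
    rcases n with _ | n <;> simp

/-- For a unimodular simplicial configuration, the `h`-polynomial of the convex hull is the
numerator of the growth series. -/
theorem growthSeries_mul_eq_hPolynomial (hsum : ∑ i, w i = 0)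
    (hspan : Submodule.span ℝ (Set.range w) = ⊤)
    (hind : ∀ G, IsFace w G → LinearIndepOn ℝ w (G : Set ι))
    (hinj : Function.Injective φ) (hφ : ∀ i, φ (u i) = w i)
    (hint : ∀ G : Finset ι, IsFace w G → ∀ (α : ι → ℝ) (l : L), φ l = ∑ i ∈ G, α i • w i →
      ∀ i ∈ G, ∃ n : ℤ, α i = n) :
    growthSeries (Set.range u) * (1 - PowerSeries.X) ^ Module.finrank ℝ E
      = (hPolynomial (convexHull ℝ (Set.range w)) : PowerSeries ℤ) := by
  rw [hPolynomial_eq_sum_faces hsum hspan hind, ← sum_faces_eq_sum_faces hsum hspan hind,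
    growthSeries_eq_sum_faces hsum hspan hind hinj hφ hint, Finset.sum_mul]
  rw [← Polynomial.coeToPowerSeries.ringHom_apply, map_sum]
  refine Finset.sum_congr rfl fun G hG => ?_
  have hle := card_le_finrank_of_face hind hG
  conv_lhs => rw [← Nat.add_sub_cancel' hle, pow_add, ← mul_assoc, ← mul_pow, mk_ite_mul_one_sub_X]
  simp

end Growth

/-! ### Sparse transportation tensors -/

/-- The indicator of a nonzero number. -/
def nonzeroIndicator (n : ℕ) : ℕ := if n = 0 then 0 else 1

/-- There is a nonnegative `a × b` matrix with all line sums equal to the lengths of the lines and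
fewer than `a + b` nonzero entries. -/
def HasSparseMatrix (a b : ℕ) : Prop :=
  ∃ z : Fin a → Fin b → ℕ, (∀ j, ∑ i, z i j = a) ∧ (∀ i, ∑ j, z i j = b) ∧
    ∑ i, ∑ j, nonzeroIndicator (z i j) + 1 ≤ a + b

theorem HasSparseMatrix.symm {a b : ℕ} (h : HasSparseMatrix a b) : HasSparseMatrix b a := by
  obtain ⟨z, h1, h2, h3⟩ := h
  refine ⟨fun i j => z j i, h2, h1, ?_⟩
  rw [Finset.sum_comm, add_comm b a]
  exact h3

theorem hasSparseMatrix_self {a : ℕ} (ha : 1 ≤ a) : HasSparseMatrix a a :=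
  ⟨fun i j => if i = j then a else 0, by simp, by simp, by
    have : ∀ i j : Fin a, nonzeroIndicator (if i = j then a else 0) = if i = j then 1 else 0 := by
      intro i j
      unfold nonzeroIndicator
      split_ifs <;> simp_all
    simp only [this]
    simp
    omega⟩

/-- Prepend the diagonal block a · I: it adds a columns and at most a nonzero entries. -/
theorem HasSparseMatrix.add {a b : ℕ} (h : HasSparseMatrix a b) : HasSparseMatrix a (a + b) := by
  obtain ⟨z, h1, h2, h3⟩ := h
  refine ⟨fun i => Fin.addCases (fun j => if i = j then a else 0) (z i), fun j => ?_, fun i => ?_,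
    ?_⟩
  · induction j using Fin.addCases with
    | left j => simp
    | right j => simpa using h1 j
  · rw [Fin.sum_univ_add]
    simp [h2]
  · have : ∀ i j : Fin a, nonzeroIndicator (if i = j then a else 0) ≤ if i = j then 1 else 0 := by
      intro i j
      unfold nonzeroIndicator
      split_ifs <;> simp_all
    have h4 : ∑ i : Fin a, ∑ j : Fin a, nonzeroIndicator (if i = j then a else 0) ≤ a := by
      refine (Finset.sum_le_sum fun i _ => Finset.sum_le_sum fun j _ => this i j).trans ?_
      simp
    simp only [Fin.sum_univ_add, Fin.addCases_left, Fin.addCases_right, Finset.sum_add_distrib]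
    omega

/-- The subtractive Euclidean algorithm on (a, b), ending in the diagonal matrix. -/
theorem hasSparseMatrix (n : ℕ) : ∀ a b : ℕ, a + b = n → 1 ≤ a → 1 ≤ b → HasSparseMatrix a b := by
  induction n using Nat.strong_induction_on with
  | _ n ih =>
    intro a b hn ha hb
    rcases lt_trichotomy a b with h | rfl | h
    · obtain ⟨c, rfl⟩ := Nat.exists_eq_add_of_lt h
      rw [add_assoc]
      exact (ih (a + (c + 1)) (by omega) a (c + 1) rfl ha (by omega)).add
    · exact hasSparseMatrix_self ha
    · obtain ⟨c, rfl⟩ := Nat.exists_eq_add_of_lt h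
      rw [add_assoc]
      exact (ih (b + (c + 1)) (by omega) b (c + 1) rfl hb (by omega)).add.symm

/-- A nonnegative `a × b × c` tensor with all line sums equal to the lengths of the lines. -/
def IsTransport {a b c : ℕ} (x : Fin a → Fin b → Fin c → ℕ) : Prop :=
  (∀ j k, ∑ i, x i j k = a) ∧ (∀ i k, ∑ j, x i j k = b) ∧ ∀ i j, ∑ k, x i j k = c

/-- The number of nonzero entries of a tensor. -/
def tensorSupport {a b c : ℕ} (x : Fin a → Fin b → Fin c → ℕ) : ℕ :=
  ∑ i, ∑ j, ∑ k, nonzeroIndicator (x i j k)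

/-- Use the cyclic shifts of a sparse a × b matrix as layers: x i j k = z (i - k) j. Sums over i and
over k both become column sums of z, and the support is a times that of z. -/
theorem exists_transport_block {a b : ℕ} (ha : 1 ≤ a) (hb : 1 ≤ b) :
    ∃ x : Fin a → Fin b → Fin a → ℕ, IsTransport x ∧ tensorSupport x + a ≤ a * (a + b) := by
  obtain ⟨z, h1, h2, h3⟩ := hasSparseMatrix _ a b rfl ha hb
  have : NeZero a := ⟨by omega⟩
  refine ⟨fun i j k => z (i - k) j, ⟨fun j k => ?_, fun i k => h2 _, fun i j => ?_⟩, ?_⟩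
  · exact (Equiv.sum_comp (Equiv.subRight k) fun i => z i j).trans (h1 j)
  · exact (Equiv.sum_comp (Equiv.subLeft i) fun i => z i j).trans (h1 j)
  · have : ∀ i, ∑ j, ∑ k, nonzeroIndicator (z (i - k) j) = ∑ i, ∑ j, nonzeroIndicator (z i j) := by
      intro i
      rw [Finset.sum_comm]
      exact Equiv.sum_comp (Equiv.subLeft i) fun i => ∑ j, nonzeroIndicator (z i j)
    simp only [tensorSupport, this, Finset.sum_const, Finset.card_univ, Fintype.card_fin,
      smul_eq_mul]
    nlinarith

/-- There is a transportation tensor with one nonzero entry fewer than at a nondegenerate vertex of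
the transportation polytope. -/
def HasSparseTensor (a b c : ℕ) : Prop :=
  ∃ x : Fin a → Fin b → Fin c → ℕ, IsTransport x ∧
    tensorSupport x + (a + b + c) ≤ a * b + b * c + c * a

theorem HasSparseTensor.rotate {a b c : ℕ} (h : HasSparseTensor a b c) :
    HasSparseTensor b c a := by
  obtain ⟨x, ⟨h1, h2, h3⟩, h4⟩ := h
  refine ⟨fun j k i => x i j k, ⟨fun k i => h2 i k, fun j i => h3 i j, fun j k => h1 j k⟩, ?_⟩
  have : tensorSupport (fun j k i => x i j k) = tensorSupport x := by
    unfold tensorSupport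
    rw [Finset.sum_comm (s := (Finset.univ : Finset (Fin a)))]
    exact Finset.sum_congr rfl fun j _ => Finset.sum_comm
  rw [this]
  linarith

theorem HasSparseTensor.swap {a b c : ℕ} (h : HasSparseTensor a b c) :
    HasSparseTensor b a c := by
  obtain ⟨x, ⟨h1, h2, h3⟩, h4⟩ := h
  refine ⟨fun j i k => x i j k, ⟨fun i k => h2 i k, fun j k => h1 j k, fun j i => h3 i j⟩, ?_⟩
  have : tensorSupport (fun j i k => x i j k) = tensorSupport x := Finset.sum_comm
  rw [this]
  linarith

/-- The circulant block suffices here because a + b ≤ a b when both are at least 2. -/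
theorem hasSparseTensor_of_eq {a b : ℕ} (ha : 2 ≤ a) (hb : 2 ≤ b) : HasSparseTensor a b a := by
  obtain ⟨x, hx, h⟩ := exists_transport_block (a := a) (b := b) (by omega) (by omega)
  refine ⟨x, hx, ?_⟩
  nlinarith

/-- Glue on a circulant block of thickness a. Its support is at most a (a + b) - a, exactly the
amount by which the allowed support grows from c to a + c. -/
theorem HasSparseTensor.add {a b c : ℕ} (ha : 1 ≤ a) (hb : 1 ≤ b) (h : HasSparseTensor a b c) :
    HasSparseTensor a b (a + c) := by
  obtain ⟨y, ⟨hy1, hy2, hy3⟩, hy⟩ := exists_transport_block ha hb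
  obtain ⟨x, ⟨hx1, hx2, hx3⟩, hx⟩ := h
  refine ⟨fun i j => Fin.addCases (y i j) (x i j), ⟨fun j k => ?_, fun i k => ?_, fun i j => ?_⟩,
    ?_⟩
  · induction k using Fin.addCases with
    | left k => simpa using hy1 j k
    | right k => simpa using hx1 j k
  · induction k using Fin.addCases with
    | left k => simpa using hy2 i k
    | right k => simpa using hx2 i k
  · rw [Fin.sum_univ_add]
    simp [hx3, hy3]
  · unfold tensorSupport at *
    simp only [Fin.sum_univ_add, Fin.addCases_left, Fin.addCases_right, Finset.sum_add_distrib]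
    linarith

theorem hasSparseTensor_of_sum (n : ℕ) : ∀ a b c : ℕ, a + b + c = n → 2 ≤ a → 2 ≤ b → 2 ≤ c →
    HasSparseTensor a b c := by
  induction n using Nat.strong_induction_on with
  | _ n ih =>
    have sorted : ∀ a b c : ℕ, a + b + c = n → 2 ≤ a → a ≤ b → b ≤ c → HasSparseTensor a b c := by
      intro a b c hn ha hab hbc
      rcases hab.eq_or_lt with rfl | hab
      · exact (hasSparseTensor_of_eq ha (by omega : 2 ≤ c)).rotate.rotate
      rcases hbc.eq_or_lt with rfl | hbc
      · exact (hasSparseTensor_of_eq (by omega : 2 ≤ b) ha).swap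
      -- Both inequalities a < b < c are strict now, so d = c - a is at least 2 and the induction
      -- hypothesis applies.
      obtain ⟨d, rfl⟩ := Nat.exists_eq_add_of_le (hab.trans hbc).le
      exact (ih (a + b + d) (by omega) a b d rfl ha (by omega) (by omega)).add
        (by omega) (by omega)
    intro a b c hn ha hb hc
    rcases le_total a b with h1 | h1 <;> rcases le_total b c with h2 | h2 <;>
      rcases le_total a c with h3 | h3
    · exact sorted a b c hn ha h1 h2
    · exact sorted a b c hn ha h1 h2
    · exact (sorted a c b (by omega) ha h3 h2).swap.rotate
    · exact (sorted c a b (by omega) hc h3 h1).rotate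
    · exact (sorted b a c (by omega) hb h1 h3).swap
    · exact (sorted b c a (by omega) hb h2 h3).rotate.rotate
    · exact (sorted c b a (by omega) hc h2 h1).swap.rotate.rotate
    · exact (sorted c b a (by omega) hc h2 h1).swap.rotate.rotate

/-- There is a transportation tensor with more zeros than the dimension of the transportation
polytope. -/
theorem exists_degenerate_transport {a b c : ℕ} (ha : 2 ≤ a) (hb : 2 ≤ b) (hc : 2 ≤ c) :
    ∃ x : Fin a → Fin b → Fin c → ℕ, IsTransport x ∧
      (a - 1) * (b - 1) * (c - 1)
        < (Finset.univ.filter fun t : Fin a × Fin b × Fin c => x t.1 t.2.1 t.2.2 = 0).card := by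
  obtain ⟨x, hx, h⟩ := hasSparseTensor_of_sum _ a b c rfl ha hb hc
  refine ⟨x, hx, ?_⟩
  have h1 : tensorSupport x
      = (Finset.univ.filter fun t : Fin a × Fin b × Fin c => ¬x t.1 t.2.1 t.2.2 = 0).card := by
    rw [Finset.card_filter, tensorSupport, Fintype.sum_prod_type]
    simp only [Fintype.sum_prod_type, nonzeroIndicator, ite_not]
  have h2 := Finset.card_filter_add_card_filter_not (s := Finset.univ)
    fun t : Fin a × Fin b × Fin c => x t.1 t.2.1 t.2.2 = 0
  rw [← h1] at h2
  simp only [Finset.card_univ, Fintype.card_prod, Fintype.card_fin] at h2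
  -- The number of zeros is at least abc - (ab + bc + ca) + (a + b + c) = (a-1)(b-1)(c-1) + 1.
  -- Shifting the variables removes truncated subtraction.
  obtain ⟨a, rfl⟩ := Nat.exists_eq_add_of_le' (show 1 ≤ a by omega)
  obtain ⟨b, rfl⟩ := Nat.exists_eq_add_of_le' (show 1 ≤ b by omega)
  obtain ⟨c, rfl⟩ := Nat.exists_eq_add_of_le' (show 1 ≤ c by omega)
  simp only [Nat.add_sub_cancel]
  nlinarith

theorem mem_of_sum_eq_zero {n : Type*} [Fintype n] [DecidableEq n] {X : Type*} [AddCommGroup X]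
    {S : AddSubgroup X} {h : n → X} (hsum : ∑ i, h i = 0) {i₀ : n} (hS : ∀ i, i ≠ i₀ → h i ∈ S)
    (i : n) : h i ∈ S := by
  by_cases hi : i = i₀
  · subst hi
    rw [← Finset.add_sum_erase _ _ (Finset.mem_univ i)] at hsum
    rw [eq_neg_of_add_eq_zero_left hsum]
    exact S.neg_mem (S.sum_mem fun j hj => hS j (Finset.ne_of_mem_erase hj))
  · exact hS i hi

/-- A family indexed by an `a × b × c` grid with vanishing line sums has rank at most
`(a - 1) (b - 1) (c - 1)`. -/
theorem card_le_of_linearIndepOn_grid {X : Type*} [AddCommGroup X] [Module ℝ X] {a b c : ℕ}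
    {g : Fin a × Fin b × Fin c → X} (ha : 0 < a) (hb : 0 < b) (hc : 0 < c)
    (h1 : ∀ j k, ∑ i, g (i, j, k) = 0) (h2 : ∀ i k, ∑ j, g (i, j, k) = 0)
    (h3 : ∀ i j, ∑ k, g (i, j, k) = 0) {S : Finset (Fin a × Fin b × Fin c)}
    (hS : LinearIndepOn ℝ g (S : Set (Fin a × Fin b × Fin c))) :
    S.card ≤ (a - 1) * (b - 1) * (c - 1) := by
  classical
  have : NeZero a := ⟨ha.ne'⟩
  have : NeZero b := ⟨hb.ne'⟩
  have : NeZero c := ⟨hc.ne'⟩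
  set T : Finset (Fin a × Fin b × Fin c) :=
    (Finset.univ.erase 0) ×ˢ (Finset.univ.erase 0) ×ˢ (Finset.univ.erase 0) with hT
  set W := Submodule.span ℝ ((T.image g : Finset X) : Set X) with hW
  have m1 : ∀ i j k, i ≠ 0 → j ≠ 0 → k ≠ 0 → g (i, j, k) ∈ W.toAddSubgroup := by
    intro i j k hi hj hk
    exact Submodule.subset_span (Finset.mem_coe.2 (Finset.mem_image_of_mem _ (by simp [*])))
  have m2 : ∀ i j k, j ≠ 0 → k ≠ 0 → g (i, j, k) ∈ W.toAddSubgroup := fun i j k hj hk =>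
    mem_of_sum_eq_zero (h1 j k) (i₀ := 0) (fun i hi => m1 i j k hi hj hk) i
  have m3 : ∀ i j k, k ≠ 0 → g (i, j, k) ∈ W.toAddSubgroup := fun i j k hk =>
    mem_of_sum_eq_zero (h2 i k) (i₀ := 0) (fun j hj => m2 i j k hj hk) j
  have m4 : ∀ i j k, g (i, j, k) ∈ W.toAddSubgroup := fun i j k =>
    mem_of_sum_eq_zero (h3 i j) (i₀ := 0) (fun k hk => m3 i j k hk) k
  have hle : Submodule.span ℝ (Set.range fun t : (S : Set (Fin a × Fin b × Fin c)) => g t) ≤ W := by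
    rw [Submodule.span_le]
    rintro _ ⟨⟨⟨i, j, k⟩, -⟩, rfl⟩
    exact m4 i j k
  have e1 := finrank_span_eq_card (R := ℝ) hS
  have e2 := Submodule.finrank_mono hle
  rw [e1] at e2
  have e3 : Module.finrank ℝ W ≤ T.card :=
    (finrank_span_finset_le_card (R := ℝ) (T.image g)).trans Finset.card_image_le
  have e4 : T.card = (a - 1) * (b - 1) * (c - 1) := by
    simp [hT, Finset.card_product, Finset.card_erase_of_mem, mul_assoc]
  have e5 : Fintype.card (S : Set (Fin a × Fin b × Fin c)) = S.card := by simp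
  omega

/-! ### Roots of unity on a grid of digits -/

section Roots

variable {m : ℕ}

/-- The index set of the `m`-th roots of unity: for every prime `p` with `p ^ α ∥ m`, a pair
`(k, j)` with `0 ≤ k < p ^ (α - 1)` and `0 ≤ j < p`. -/
abbrev RootIndex (m : ℕ) : Type :=
  (p : m.primeFactors) → Fin ((p : ℕ) ^ (m.factorization p - 1)) × Fin (p : ℕ)

/-- The root of unity with given digits. -/
def rootOf (m : ℕ) (e : RootIndex m) : ℂ :=
  ∏ p : m.primeFactors,
    zeta ((p : ℕ) ^ m.factorization p) ^
      (((e p).1 : ℕ) + ((e p).2 : ℕ) * (p : ℕ) ^ (m.factorization p - 1))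

/-- The inclusion of the chosen basis into the roots of unity. -/
def basisRoot (b : BasisIndex m) : RootIndex m := fun p =>
  ((b p).1, Fin.castLE (Nat.sub_le _ _) (b p).2)

/-- Change of the leading digit at a prime. -/
def setDigit (e : RootIndex m) (p : m.primeFactors) (j : Fin (p : ℕ)) : RootIndex m :=
  Function.update e p ((e p).1, j)

theorem setDigit_self (e : RootIndex m) (p : m.primeFactors) : setDigit e p (e p).2 = e := by
  simp [setDigit]

theorem setDigit_apply_self (e : RootIndex m) (p : m.primeFactors) (j : Fin (p : ℕ)) :
    setDigit e p j p = ((e p).1, j) := by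
  simp [setDigit]

theorem setDigit_apply_of_ne (e : RootIndex m) {p q : m.primeFactors} (h : q ≠ p)
    (j : Fin (p : ℕ)) : setDigit e p j q = e q := by
  simp [setDigit, h]

theorem setDigit_fst (e : RootIndex m) (p q : m.primeFactors) (j : Fin (p : ℕ)) :
    (setDigit e p j q).1 = (e q).1 := by
  by_cases h : q = p
  · subst h; simp [setDigit]
  · rw [setDigit_apply_of_ne e h]

theorem setDigit_setDigit (e : RootIndex m) (p : m.primeFactors) (i j : Fin (p : ℕ)) :
    setDigit (setDigit e p i) p j = setDigit e p j := by
  simp [setDigit]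

theorem setDigit_comm (e : RootIndex m) {p q : m.primeFactors} (h : p ≠ q) (i : Fin (p : ℕ))
    (j : Fin (q : ℕ)) : setDigit (setDigit e p i) q j = setDigit (setDigit e q j) p i := by
  simp only [setDigit, Function.update_of_ne h, Function.update_of_ne h.symm]
  exact Function.update_comm h _ _ _

/-- A function on the roots of unity whose sum over every coset of the `p`-th roots of unity
vanishes, for all primes `p ∣ m`. -/
def HasZeroLineSums {X : Type*} [AddCommGroup X] (f : RootIndex m → X) : Prop :=
  ∀ e p, ∑ j, f (setDigit e p j) = 0

theorem pos_of_mem (p : m.primeFactors) : 0 < (p : ℕ) := (Nat.prime_of_mem_primeFactors p.2).pos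

/-- A function with vanishing line sums is determined by its values on the chosen basis. -/
theorem HasZeroLineSums.mem {X : Type*} [AddCommGroup X] {f : RootIndex m → X}
    (hf : HasZeroLineSums f) {S : AddSubgroup X} (hS : ∀ b, f (basisRoot b) ∈ S)
    (e : RootIndex m) : f e ∈ S := by
  -- Induct on the number of primes at which the leading digit is p - 1, the value missing from the
  -- basis. A vanishing line sum trades such a digit for the smaller ones.
  induction hn : (Finset.univ.filter fun p : m.primeFactors => ((e p).2 : ℕ) = p - 1).card
    using Nat.strong_induction_on generalizing e with
  | _ n ih =>
    by_cases h : ∃ p : m.primeFactors, ((e p).2 : ℕ) = p - 1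
    · obtain ⟨p, hp⟩ := h
      have hpos := pos_of_mem p
      rw [← setDigit_self e p]
      refine mem_of_sum_eq_zero (h := fun j => f (setDigit e p j)) (hf e p)
        (i₀ := ⟨p - 1, by omega⟩) (fun j hj => ih _ ?_ _ rfl) _
      rw [← hn]
      refine Finset.card_lt_card ⟨fun q hq => ?_, fun hsub => ?_⟩
      · simp only [Finset.mem_filter, Finset.mem_univ, true_and] at hq ⊢
        by_cases hqp : q = p
        · subst hqp; exact hp
        · rwa [setDigit_apply_of_ne e hqp] at hq
      · have := hsub (Finset.mem_filter.2 ⟨Finset.mem_univ p, hp⟩)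
        simp only [Finset.mem_filter, Finset.mem_univ, true_and, setDigit_apply_self] at this
        exact hj (Fin.ext this)
    · push Not at h
      have hlt : ∀ p : m.primeFactors, ((e p).2 : ℕ) < p - 1 := fun p => by
        have := h p
        have := (e p).2.isLt
        omega
      have : e = basisRoot fun p => ((e p).1, ⟨(e p).2, hlt p⟩) := rfl
      rw [this]
      exact hS _

theorem HasZeroLineSums.map {X Y : Type*} [AddCommGroup X] [AddCommGroup Y] {f : RootIndex m → X}
    (hf : HasZeroLineSums f) (g : X →+ Y) : HasZeroLineSums fun e => g (f e) := fun e p => by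
  rw [← map_sum, hf e p, map_zero]

/-- Sum over pairs (e, j), reindexed by the involution that exchanges j with the digit of e at p.
This shows that p times the sum is a combination of line sums of f, hence zero. -/
theorem sum_smul_eq_zero_of_const {X : Type*} [AddCommGroup X] [Module ℝ X] {f : RootIndex m → X}
    (hf : HasZeroLineSums f) {β : RootIndex m → ℝ} (p : m.primeFactors)
    (hβ : ∀ e j, β (setDigit e p j) = β e) : ∑ e, β e • f e = 0 := by
  have hinv : Function.Involutive fun t : RootIndex m × Fin (p : ℕ) =>
      (setDigit t.1 p t.2, (t.1 p).2) := by
    rintro ⟨e, j⟩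
    simp only [setDigit_setDigit, setDigit_self, setDigit_apply_self]
  have h1 : ∑ t : RootIndex m × Fin (p : ℕ), β (setDigit t.1 p t.2) • f (setDigit t.1 p t.2)
      = ∑ t : RootIndex m × Fin (p : ℕ), β t.1 • f t.1 :=
    Equiv.sum_comp hinv.toPerm fun t => β t.1 • f t.1
  rw [Fintype.sum_prod_type, Fintype.sum_prod_type] at h1
  simp only [hβ, ← Finset.smul_sum, hf _ p, smul_zero, Finset.sum_const_zero, Finset.sum_const,
    Finset.card_univ, Fintype.card_fin] at h1
  have hp : (p : ℕ) ≠ 0 := (pos_of_mem p).ne'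
  have h2 : (p : ℝ) • ∑ e, β e • f e = 0 := by
    rw [h1, Finset.smul_sum]
    exact Finset.sum_congr rfl fun e _ => by rw [← Nat.cast_smul_eq_nsmul ℝ, smul_comm]
  exact (smul_eq_zero.1 h2).resolve_left (Nat.cast_ne_zero.2 hp)

theorem zeta_isPrimitiveRoot {n : ℕ} (hn : n ≠ 0) : IsPrimitiveRoot (zeta n) n :=
  Complex.isPrimitiveRoot_exp n hn

theorem zeta_prime_pow_isPrimitiveRoot (p : m.primeFactors) :
    IsPrimitiveRoot (zeta ((p : ℕ) ^ m.factorization p)) ((p : ℕ) ^ m.factorization p) :=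
  zeta_isPrimitiveRoot (pow_ne_zero _ (pos_of_mem p).ne')

theorem factorization_pos (p : m.primeFactors) : 0 < m.factorization p :=
  (Nat.prime_of_mem_primeFactors p.2).factorization_pos_of_dvd
    (Nat.mem_primeFactors.1 p.2).2.2 (Nat.dvd_of_mem_primeFactors p.2)

theorem prime_pow_eq (p : m.primeFactors) :
    (p : ℕ) ^ m.factorization p = (p : ℕ) ^ (m.factorization p - 1) * p := by
  rw [← pow_succ, Nat.sub_add_cancel (factorization_pos p)]

theorem rootOf_pow (e : RootIndex m) : rootOf m e ^ m = 1 := by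
  rw [rootOf, ← Finset.prod_pow]
  refine Finset.prod_eq_one fun p _ => ?_
  rw [← pow_mul, mul_comm, pow_mul, (zeta_prime_pow_isPrimitiveRoot p).pow_eq_one_iff_dvd _ |>.2
    (Nat.ordProj_dvd m p), one_pow]

/-- Varying the leading digit at p multiplies a fixed number by the powers of a primitive p-th root
of unity, whose sum vanishes. -/
theorem rootOf_hasZeroLineSums : HasZeroLineSums (rootOf m) := by
  intro e p
  have h1 : ∀ j, rootOf m (setDigit e p j) =
      (zeta ((p : ℕ) ^ m.factorization p) ^ ((e p).1 : ℕ) * ∏ q ∈ Finset.univ.erase p,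
        zeta ((q : ℕ) ^ m.factorization q) ^
          (((e q).1 : ℕ) + ((e q).2 : ℕ) * (q : ℕ) ^ (m.factorization q - 1))) *
      (zeta ((p : ℕ) ^ m.factorization p) ^ ((p : ℕ) ^ (m.factorization p - 1))) ^ (j : ℕ) := by
    intro j
    rw [rootOf, ← Finset.mul_prod_erase _ _ (Finset.mem_univ p), setDigit_apply_self, pow_add,
      mul_comm (j : ℕ), pow_mul, mul_assoc, mul_assoc]
    congr 1
    rw [mul_comm]
    congr 1
    refine Finset.prod_congr rfl fun q hq => ?_
    rw [setDigit_apply_of_ne e (Finset.ne_of_mem_erase hq)]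
  have h2 : IsPrimitiveRoot
      (zeta ((p : ℕ) ^ m.factorization p) ^ ((p : ℕ) ^ (m.factorization p - 1))) p :=
    (zeta_prime_pow_isPrimitiveRoot p).pow (pow_pos (pos_of_mem p) _) (prime_pow_eq p)
  simp only [h1, ← Finset.mul_sum]
  rw [Fin.sum_univ_eq_sum_range (fun j =>
      (zeta ((p : ℕ) ^ m.factorization p) ^ ((p : ℕ) ^ (m.factorization p - 1))) ^ j) p,
    h2.geom_sum_eq_zero (Nat.prime_of_mem_primeFactors p.2).one_lt, mul_zero]

theorem digit_lt (e : RootIndex m) (p : m.primeFactors) :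
    ((e p).1 : ℕ) + ((e p).2 : ℕ) * (p : ℕ) ^ (m.factorization p - 1)
      < (p : ℕ) ^ m.factorization p := by
  have h1 := (e p).1.isLt
  have h2 := (e p).2.isLt
  rw [prime_pow_eq]
  nlinarith

/-- Raising to the power m / p^α kills the factors at the other primes and leaves a power of a
primitive p^α-th root of unity. Its exponent is determined, and reduction modulo p^(α-1) separates
the two digits. -/
theorem rootOf_injective (hm : m ≠ 0) : Function.Injective (rootOf m) := by
  intro e e' h
  funext p
  have hp := Nat.prime_of_mem_primeFactors p.2
  have hpow : ∀ e : RootIndex m, rootOf m e ^ (m / (p : ℕ) ^ m.factorization p) =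
      (zeta ((p : ℕ) ^ m.factorization p) ^ (m / (p : ℕ) ^ m.factorization p)) ^
        (((e p).1 : ℕ) + ((e p).2 : ℕ) * (p : ℕ) ^ (m.factorization p - 1)) := by
    intro e
    rw [rootOf, ← Finset.prod_pow, Finset.prod_eq_single p]
    · rw [← pow_mul, ← pow_mul, mul_comm]
    · intro q _ hqp
      rw [← pow_mul, mul_comm, pow_mul,
        (zeta_prime_pow_isPrimitiveRoot q).pow_eq_one_iff_dvd _ |>.2, one_pow]
      have hcop : Nat.Coprime ((q : ℕ) ^ m.factorization q) ((p : ℕ) ^ m.factorization p) :=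
        Nat.Coprime.pow _ _ ((Nat.coprime_primes (Nat.prime_of_mem_primeFactors q.2) hp).2
          fun h => hqp (Subtype.ext h))
      refine hcop.dvd_of_dvd_mul_left ?_
      rw [Nat.mul_div_cancel' (Nat.ordProj_dvd m p)]
      exact Nat.ordProj_dvd m q
    · simp
  have hprim := (zeta_prime_pow_isPrimitiveRoot p).pow_of_coprime
    (m / (p : ℕ) ^ m.factorization p) ((Nat.coprime_ordCompl hp hm).symm.pow_right _)
  have h1 := hprim.pow_inj (digit_lt e p) (digit_lt e' p) (by rw [← hpow, ← hpow, h])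
  have h2 := congrArg (· % (p : ℕ) ^ (m.factorization p - 1)) h1
  simp only [Nat.add_mul_mod_self_right, Nat.mod_eq_of_lt (e p).1.isLt,
    Nat.mod_eq_of_lt (e' p).1.isLt] at h2
  rw [h2] at h1
  have h3 := Nat.eq_of_mul_eq_mul_right (pow_pos hp.pos _) (Nat.add_left_cancel h1)
  exact Prod.ext (Fin.ext h2) (Fin.ext h3)

theorem card_rootIndex (hm : m ≠ 0) : Fintype.card (RootIndex m) = m := by
  rw [Fintype.card_pi]
  simp only [Fintype.card_prod, Fintype.card_fin, ← prime_pow_eq]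
  rw [Finset.prod_coe_sort m.primeFactors fun p => p ^ m.factorization p]
  exact Nat.prod_factorization_pow_eq_self hm

theorem card_basisIndex (hm : m ≠ 0) : Fintype.card (BasisIndex m) = m.totient := by
  rw [Fintype.card_pi, Nat.totient_eq_prod_factorization hm]
  simp only [Fintype.card_prod, Fintype.card_fin]
  exact Finset.prod_coe_sort m.primeFactors fun p => p ^ (m.factorization p - 1) * (p - 1)

theorem exists_rootOf_eq (hm : m ≠ 0) {z : ℂ} (hz : z ^ m = 1) : ∃ e, rootOf m e = z := by
  classical
  have hsub : Finset.univ.image (rootOf m) ⊆ Polynomial.nthRootsFinset m (1 : ℂ) := by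
    intro z hz
    obtain ⟨e, -, rfl⟩ := Finset.mem_image.1 hz
    exact (Polynomial.mem_nthRootsFinset (Nat.pos_of_ne_zero hm) _).2 (rootOf_pow e)
  have heq := Finset.eq_of_subset_of_card_le hsub (by
    rw [Finset.card_image_of_injective _ (rootOf_injective hm), Finset.card_univ,
      card_rootIndex hm, (zeta_isPrimitiveRoot hm).card_nthRootsFinset])
  have : z ∈ Finset.univ.image (rootOf m) :=
    heq ▸ (Polynomial.mem_nthRootsFinset (Nat.pos_of_ne_zero hm) _).2 hz
  obtain ⟨e, -, he⟩ := Finset.mem_image.1 this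
  exact ⟨e, he⟩

/-- Needed over ℤ, where it says that the chosen elements generate the lattice, and over ℚ, where it
gives their independence by a dimension count. -/
theorem adjoin_le_span_basisElement (R : Type*) [CommRing R] [Algebra R ℂ] (hm : m ≠ 0) :
    Subalgebra.toSubmodule (Algebra.adjoin R {zeta m})
      ≤ Submodule.span R (Set.range (basisElement m)) := by
  rw [Algebra.adjoin_eq_span, Submodule.span_le]
  intro z hz
  obtain ⟨n, rfl⟩ := Submonoid.mem_closure_singleton.1 hz
  obtain ⟨e, he⟩ := exists_rootOf_eq hm (z := zeta m ^ n) (by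
    rw [← pow_mul, mul_comm, pow_mul, (zeta_isPrimitiveRoot hm).pow_eq_one, one_pow])
  rw [← he]
  exact rootOf_hasZeroLineSums.mem
    (S := (Submodule.span R (Set.range (basisElement m))).toAddSubgroup)
    (fun b => Submodule.subset_span ⟨b, rfl⟩) e

/-- There are φ(m) elements, and they span a space containing ℚ(ζ_m), whose dimension is the degree
φ(m) of the cyclotomic polynomial. -/
theorem linearIndependent_basisElement (hm : m ≠ 0) : LinearIndependent ℚ (basisElement m) := by
  have hint : IsIntegral ℚ (zeta m) :=
    ((zeta_isPrimitiveRoot hm).isIntegral (Nat.pos_of_ne_zero hm)).tower_top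
  rw [linearIndependent_iff_card_le_finrank_span, card_basisIndex hm]
  have h1 : Module.finrank ℚ (Algebra.adjoin ℚ {zeta m}) = m.totient := by
    rw [(Algebra.adjoin.powerBasis hint).finrank, Algebra.adjoin.powerBasis_dim,
      ← Polynomial.cyclotomic_eq_minpoly_rat (zeta_isPrimitiveRoot hm) (Nat.pos_of_ne_zero hm),
      Polynomial.natDegree_cyclotomic]
  rw [← h1]
  have : FiniteDimensional ℚ (Submodule.span ℚ (Set.range (basisElement m))) :=
    FiniteDimensional.span_of_finite ℚ (Set.finite_range _)
  exact Submodule.finrank_mono (adjoin_le_span_basisElement ℚ hm)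

end Roots

/-! ### The cyclotomic lattice in coordinates -/

section Lattice

variable {m : ℕ}

theorem mem_cyclotomicLattice_of_pow (hm : m ≠ 0) {z : ℂ} (hz : z ^ m = 1) :
    z ∈ cyclotomicLattice m := by
  have : NeZero m := ⟨hm⟩
  obtain ⟨i, -, rfl⟩ := (zeta_isPrimitiveRoot hm).eq_pow_of_pow_eq_one hz
  exact pow_mem (Algebra.self_mem_adjoin_singleton ℤ (zeta m)) i

/-- The roots of unity as elements of the lattice. -/
def latticeRoot (hm : m ≠ 0) (e : RootIndex m) : cyclotomicLattice m :=
  ⟨rootOf m e, mem_cyclotomicLattice_of_pow hm (rootOf_pow e)⟩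

theorem coe_sum_smul_latticeRoot (hm : m ≠ 0) (c : BasisIndex m → ℤ) :
    ((∑ b, c b • latticeRoot hm (basisRoot b) : cyclotomicLattice m) : ℂ)
      = ∑ b, c b • basisElement m b := by
  rw [AddSubmonoidClass.coe_finsetSum]
  rfl

/-- The chosen basis of the lattice `ℤ[ζ_m]`. -/
def latticeBasis (hm : m ≠ 0) : Module.Basis (BasisIndex m) ℤ (cyclotomicLattice m) :=
  Module.Basis.mk (v := fun b => latticeRoot hm (basisRoot b))
    (LinearIndependent.of_comp (cyclotomicLattice m).val.toLinearMap
      (LinearIndependent.restrict_scalars (R := ℤ) (K := ℚ)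
        (fun a b h => by simpa using h) (linearIndependent_basisElement hm)))
    (by
      rintro x -
      obtain ⟨c, hc⟩ := (Submodule.mem_span_range_iff_exists_fun ℤ).1
        (adjoin_le_span_basisElement ℤ hm x.2)
      exact (Submodule.mem_span_range_iff_exists_fun ℤ).2
        ⟨c, Subtype.ext ((coe_sum_smul_latticeRoot hm c).trans hc)⟩)

theorem latticeBasis_apply (hm : m ≠ 0) (b : BasisIndex m) :
    latticeBasis hm b = latticeRoot hm (basisRoot b) := by
  simp [latticeBasis]

/-- The coordinates of a lattice element, as a vector in `ℝ^{φ(m)}`. -/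
def latticeCoord (hm : m ≠ 0) : cyclotomicLattice m →+ (BasisIndex m → ℝ) where
  toFun x b := ((latticeBasis hm).repr x b : ℝ)
  map_zero' := by ext b; simp
  map_add' x y := by ext b; simp

theorem latticeCoord_apply (hm : m ≠ 0) (x : cyclotomicLattice m) (b : BasisIndex m) :
    latticeCoord hm x b = ((latticeBasis hm).repr x b : ℝ) := rfl

theorem latticeCoord_injective (hm : m ≠ 0) : Function.Injective (latticeCoord hm) := by
  intro x y h
  refine (latticeBasis hm).repr.injective (Finsupp.ext fun b => ?_)
  have := congrFun h b
  rw [latticeCoord_apply, latticeCoord_apply] at this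
  exact_mod_cast this

/-- The vertices of the cyclotomic polytope. -/
def rootVector (hm : m ≠ 0) (e : RootIndex m) : BasisIndex m → ℝ :=
  latticeCoord hm (latticeRoot hm e)

theorem rootVector_basisRoot (hm : m ≠ 0) (b : BasisIndex m) :
    rootVector hm (basisRoot b) = Pi.single b 1 := by
  classical
  ext b'
  rw [rootVector, ← latticeBasis_apply, latticeCoord_apply, Module.Basis.repr_self,
    Finsupp.single_apply, Pi.single_apply]
  simp [eq_comm]

theorem latticeRoot_hasZeroLineSums (hm : m ≠ 0) : HasZeroLineSums (latticeRoot hm) := by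
  intro e p
  refine Subtype.ext ?_
  rw [AddSubmonoidClass.coe_finsetSum]
  exact rootOf_hasZeroLineSums e p

theorem rootVector_hasZeroLineSums (hm : m ≠ 0) : HasZeroLineSums (rootVector hm) :=
  (latticeRoot_hasZeroLineSums hm).map (latticeCoord hm)

theorem range_latticeRoot (hm : m ≠ 0) : Set.range (latticeRoot hm) = latticeRootsOfUnity m := by
  ext x
  constructor
  · rintro ⟨e, rfl⟩
    exact Subtype.ext (rootOf_pow e)
  · intro hx
    obtain ⟨e, he⟩ := exists_rootOf_eq hm (z := x) (congrArg Subtype.val hx)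
    exact ⟨e, Subtype.ext he⟩

theorem range_rootVector (hm : m ≠ 0) : Set.range (rootVector hm) = rootVectors m := by
  ext v
  constructor
  · rintro ⟨e, rfl⟩
    refine ⟨fun b => (latticeBasis hm).repr (latticeRoot hm e) b, ?_, rfl⟩
    have h := congrArg Subtype.val ((latticeBasis hm).sum_repr (latticeRoot hm e))
    simp only [latticeBasis_apply] at h
    rw [coe_sum_smul_latticeRoot] at h
    simp only [zsmul_eq_mul] at h
    rw [h]
    exact rootOf_pow e
  · rintro ⟨c, hc, rfl⟩
    obtain ⟨e, he⟩ := exists_rootOf_eq hm hc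
    refine ⟨e, ?_⟩
    have h : latticeRoot hm e = ∑ b, c b • latticeBasis hm b := by
      simp only [latticeBasis_apply]
      refine Subtype.ext ?_
      rw [coe_sum_smul_latticeRoot]
      simp only [zsmul_eq_mul]
      exact he
    ext b
    rw [rootVector, latticeCoord_apply, h, Module.Basis.repr_sum_self]

theorem cyclotomicPolytope_eq (hm : m ≠ 0) :
    cyclotomicPolytope m = convexHull ℝ (Set.range (rootVector hm)) := by
  rw [range_rootVector, cyclotomicPolytope]

theorem finrank_cyclotomicLattice (hm : m ≠ 0) :
    Module.finrank ℤ (cyclotomicLattice m) = Module.finrank ℝ (BasisIndex m → ℝ) := by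
  rw [Module.finrank_eq_card_basis (latticeBasis hm), Module.finrank_fintype_fun_eq_card]

theorem span_rootVector (hm : m ≠ 0) : Submodule.span ℝ (Set.range (rootVector hm)) = ⊤ := by
  classical
  rw [eq_top_iff, ← (Pi.basisFun ℝ (BasisIndex m)).span_eq]
  refine Submodule.span_mono ?_
  rintro _ ⟨b, rfl⟩
  exact ⟨basisRoot b, by rw [rootVector_basisRoot, Pi.basisFun_apply]⟩

theorem sum_rootVector (hm : m ≠ 0) (p : m.primeFactors) : ∑ e, rootVector hm e = 0 := by
  simpa using sum_smul_eq_zero_of_const (rootVector_hasZeroLineSums hm) (β := fun _ => 1) p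
    fun _ _ => rfl

/-- Functions on the roots of unity with vanishing line sums extend to linear maps. -/
theorem HasZeroLineSums.exists_linearMap {X : Type*} [AddCommGroup X] [Module ℝ X]
    {f : RootIndex m → X} (hf : HasZeroLineSums f) (hm : m ≠ 0) :
    ∃ A : (BasisIndex m → ℝ) →ₗ[ℝ] X, ∀ e, A (rootVector hm e) = f e := by
  classical
  refine ⟨Fintype.linearCombination ℝ fun b => f (basisRoot b), fun e => ?_⟩
  set A := Fintype.linearCombination ℝ fun b : BasisIndex m => f (basisRoot b)
  have h : HasZeroLineSums fun e => A (rootVector hm e) - f e := by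
    intro e p
    rw [Finset.sum_sub_distrib, hf e p, ← map_sum, rootVector_hasZeroLineSums hm e p, map_zero,
      sub_zero]
  have := h.mem (S := ⊥) (fun b => by
    rw [AddSubgroup.mem_bot, rootVector_basisRoot, sub_eq_zero]
    simp [A]) e
  exact sub_eq_zero.1 (AddSubgroup.mem_bot.1 this)

/-- The functional is z ↦ Re(z · conj ζ) on roots of unity, where ζ is the root of index e. It
extends to ℝ^φ(m) because it has zero line sums. On the unit circle its value 1 is attained only at
ζ, so each root gives a vertex. -/
theorem exists_supporting_functional (hm : m ≠ 0) (e : RootIndex m) :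
    ∃ a : (BasisIndex m → ℝ) →ₗ[ℝ] ℝ, a (rootVector hm e) = 1 ∧
      ∀ e', e' ≠ e → a (rootVector hm e') < 1 := by
  have hf := (rootOf_hasZeroLineSums (m := m)).map
    (Complex.reAddGroupHom.comp (AddMonoidHom.mulRight ((starRingEnd ℂ) (rootOf m e))))
  obtain ⟨a, ha⟩ := hf.exists_linearMap hm
  have hnorm : ∀ e, ‖rootOf m e‖ = 1 := fun e => Complex.norm_eq_one_of_pow_eq_one (rootOf_pow e) hm
  have hmul : rootOf m e * (starRingEnd ℂ) (rootOf m e) = 1 := by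
    rw [Complex.mul_conj, Complex.normSq_eq_norm_sq, hnorm]; simp
  have ha' : ∀ e', a (rootVector hm e') = (rootOf m e' * (starRingEnd ℂ) (rootOf m e)).re := ha
  refine ⟨a, by rw [ha', hmul, Complex.one_re], fun e' hne => ?_⟩
  rw [ha']
  set z := rootOf m e' * (starRingEnd ℂ) (rootOf m e) with hz
  have hz1 : ‖z‖ = 1 := by rw [hz, norm_mul, RCLike.norm_conj, hnorm, hnorm, one_mul]
  refine lt_of_le_of_ne (hz1 ▸ Complex.re_le_norm z) fun hre => hne ?_
  have him : z.im = 0 := by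
    have h1 := Complex.normSq_eq_norm_sq z
    rw [hz1, Complex.normSq_apply, hre] at h1
    nlinarith
  have hone : z = 1 := Complex.ext (by simp [hre]) (by simp [him])
  refine rootOf_injective hm ?_
  have h2 : (starRingEnd ℂ) (rootOf m e) ≠ 0 := fun h => by simp [h] at hmul
  exact mul_right_cancel₀ h2 ((hz ▸ hone).trans hmul.symm)

end Lattice

/-! ### Unimodularity for at most two primes -/

section Unimodular

variable {m : ℕ}

/-- The functions that are constant on the cosets of the `p`-th roots of unity. -/
def lineConstant (p : m.primeFactors) : Submodule ℝ (RootIndex m → ℝ) where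
  carrier := {β | ∀ e j, β (setDigit e p j) = β e}
  zero_mem' _ _ := rfl
  add_mem' hβ hγ e j := congrArg₂ (· + ·) (hβ e j) (hγ e j)
  smul_mem' c _ hβ e j := congrArg (c * ·) (hβ e j)

theorem sum_single_setDigit_mem (e : RootIndex m) (p : m.primeFactors) :
    ∑ j, (Pi.single (setDigit e p j) 1 : RootIndex m → ℝ) ∈ lineConstant p := by
  have h : ∀ e', (∑ j, (Pi.single (setDigit e p j) 1 : RootIndex m → ℝ)) e'
      = if e' = setDigit e p (e' p).2 then 1 else 0 := by
    intro e'
    rw [Finset.sum_apply, Finset.sum_eq_single (e' p).2]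
    · rw [Pi.single_apply]
    · intro j _ hj
      rw [Pi.single_apply, if_neg]
      intro h
      exact hj (by rw [h, setDigit_apply_self])
    · simp
  intro e' j
  rw [h, h]
  refine if_congr ?_ rfl rfl
  rw [setDigit_apply_self]
  constructor
  · intro h
    have := congrArg (fun t => setDigit t p (e' p).2) h
    simpa only [setDigit_setDigit, setDigit_self] using this
  · intro h
    have := congrArg (fun t => setDigit t p j) h
    simpa only [setDigit_setDigit] using this

/-- Every linear relation among the roots of unity comes from the vanishing line sums. -/
theorem mem_iSup_lineConstant (hm : m ≠ 0) {y : RootIndex m → ℝ}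
    (hy : ∑ e, y e • rootVector hm e = 0) : y ∈ ⨆ p, lineConstant (m := m) p := by
  set W : Submodule ℝ (RootIndex m → ℝ) := ⨆ p, lineConstant p
  -- Modulo W the unit vectors have zero line sums, since the indicator of a coset is constant on
  -- cosets. So they define a linear map on ℝ^φ(m), which sends the given relation to the class of
  -- y.
  have hf : HasZeroLineSums fun e : RootIndex m => W.mkQ (Pi.single e 1) := by
    intro e p
    rw [← map_sum, Submodule.mkQ_apply, Submodule.Quotient.mk_eq_zero]
    exact Submodule.mem_iSup_of_mem p (sum_single_setDigit_mem e p)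
  obtain ⟨A, hA⟩ := hf.exists_linearMap hm
  have h := congrArg A hy
  simp only [map_sum, map_smul, hA, map_zero] at h
  simp only [← map_smul, ← map_sum] at h
  rw [Submodule.mkQ_apply, Submodule.Quotient.mk_eq_zero] at h
  convert h using 1
  ext e
  simp [Finset.sum_apply, Pi.single_apply]

theorem exists_int_combination (hm : m ≠ 0) (l : cyclotomicLattice m) :
    ∃ x : RootIndex m → ℤ, latticeCoord hm l = ∑ e, (x e : ℝ) • rootVector hm e := by
  have hl : l ∈ Submodule.span ℤ (Set.range (latticeRoot hm)) := by
    rw [← (latticeBasis hm).sum_repr l]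
    refine Submodule.sum_mem _ fun b _ => Submodule.smul_mem _ _ (Submodule.subset_span ?_)
    exact ⟨basisRoot b, (latticeBasis_apply hm b).symm⟩
  obtain ⟨x, rfl⟩ := (Submodule.mem_span_range_iff_exists_fun ℤ).1 hl
  refine ⟨x, ?_⟩
  rw [map_sum]
  exact Finset.sum_congr rfl fun e _ => by rw [map_zsmul, Int.cast_smul_eq_zsmul]; rfl

/-- If at most two primes divide `m`, the coordinates of a lattice vector with respect to linearly
independent roots of unity are integers. -/
theorem exists_int_coord (hm : m ≠ 0) {p q : m.primeFactors} (hpq : ∀ r, r = p ∨ r = q)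
    {G : Finset (RootIndex m)} (hG : LinearIndepOn ℝ (rootVector hm) (G : Set (RootIndex m)))
    (α : RootIndex m → ℝ) (l : cyclotomicLattice m)
    (hl : latticeCoord hm l = ∑ e ∈ G, α e • rootVector hm e) :
    ∀ e ∈ G, ∃ n : ℤ, α e = n := by
  classical
  obtain ⟨x, hx⟩ := exists_int_combination hm l
  have hsum : ∑ e, (if e ∈ G then α e else 0) • rootVector hm e
      = ∑ e ∈ G, α e • rootVector hm e := by
    simp only [ite_smul, zero_smul]
    rw [Finset.sum_ite_mem, Finset.univ_inter]
  have hy : (fun e => (x e : ℝ) - if e ∈ G then α e else 0) ∈ lineConstant p ⊔ lineConstant q := by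
    have h := mem_iSup_lineConstant hm
      (y := fun e => (x e : ℝ) - if e ∈ G then α e else 0) (by
        simp only [sub_smul, Finset.sum_sub_distrib]
        rw [← hx, hl, hsum, sub_self])
    refine (iSup_le fun r => ?_ : ⨆ r, lineConstant (m := m) r ≤ _) h
    rcases hpq r with rfl | rfl
    exacts [le_sup_left, le_sup_right]
  obtain ⟨β, hβ, γ, hγ, hβγ⟩ := Submodule.mem_sup.1 hy
  have hβγ' : ∀ e, β e + γ e = (x e : ℝ) - if e ∈ G then α e else 0 := fun e => congrFun hβγ e
  -- Off G the sum β + γ is the integer x, so ⌊β⌋ + ⌈γ⌉ = x as well. The rounded functions are still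
  -- constant on cosets and hence relations; subtracting them from x gives an integral combination
  -- supported on G.
  have hoff : ∀ e, e ∉ G → x e - ⌊β e⌋ - ⌈γ e⌉ = 0 := by
    intro e he
    have h1 : γ e = (x e : ℝ) - β e := by
      have := hβγ' e
      rw [if_neg he] at this
      linarith
    have h2 : (x e : ℝ) - β e = -(β e) + (x e : ℝ) := by ring
    rw [h1, h2, Int.ceil_add_intCast, Int.ceil_neg]
    ring
  have h1 := sum_smul_eq_zero_of_const (rootVector_hasZeroLineSums hm)
    (β := fun e => (⌊β e⌋ : ℝ)) p fun e j => by rw [hβ e j]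
  have h2 := sum_smul_eq_zero_of_const (rootVector_hasZeroLineSums hm)
    (β := fun e => (⌈γ e⌉ : ℝ)) q fun e j => by rw [hγ e j]
  have h3 : ∑ e ∈ G, ((x e - ⌊β e⌋ - ⌈γ e⌉ : ℤ) : ℝ) • rootVector hm e
      = ∑ e ∈ G, α e • rootVector hm e := by
    rw [Finset.sum_subset (Finset.subset_univ G) fun e _ he => by rw [hoff e he]; simp, ← hl, hx]
    simp only [Int.cast_sub, sub_smul, Finset.sum_sub_distrib]
    rw [h1, h2, sub_zero, sub_zero]
  exact fun e he => ⟨_, (eq_on_of_sum_eq hG h3 e he).symm⟩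

end Unimodular

/-! ### Three primes: the cyclotomic polytope is not simplicial -/

section ThreePrimes

variable {m : ℕ}

/-- The root of unity all of whose digits vanish. -/
def zeroIndex (m : ℕ) : RootIndex m := fun p => (⟨0, pow_pos (pos_of_mem p) _⟩, ⟨0, pos_of_mem p⟩)

/-- The weight of a digit at an auxiliary prime. -/
def digitWeight (s : m.primeFactors) (j : Fin (s : ℕ)) : ℝ :=
  if (j : ℕ) = 0 then 1 else -((s : ℝ) - 1)⁻¹

theorem sum_digitWeight (s : m.primeFactors) : ∑ j, digitWeight s j = 0 := by
  have h2 := (Nat.prime_of_mem_primeFactors s.2).two_le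
  obtain ⟨n, hn⟩ := Nat.exists_eq_add_of_le' h2
  have hn0 : (n : ℝ) + 1 ≠ 0 := by positivity
  unfold digitWeight
  rw [Fin.sum_univ_eq_sum_range (fun j => if j = 0 then (1 : ℝ) else -((s : ℝ) - 1)⁻¹) s]
  have hs : (s : ℝ) = n + 2 := by exact_mod_cast hn
  rw [hs, hn, Finset.sum_range_succ']
  simp only [Nat.add_eq_zero_iff, one_ne_zero, and_false, if_false, Finset.sum_const,
    Finset.card_range, nsmul_eq_mul, if_true]
  have : (n : ℝ) + 2 - 1 = n + 1 := by ring
  rw [this]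
  push_cast
  field_simp
  ring

/-- If all digits on D vanish the product is 1. Otherwise some factor is -1/(s-1), of modulus at
most 1/t, and the others have modulus at most 1. -/
theorem prod_digitWeight {t : ℝ} (ht : 1 ≤ t) (e : RootIndex m) (D : Finset m.primeFactors)
    (hD : ∀ s ∈ D, t ≤ (s : ℝ) - 1) :
    ∏ s ∈ D, digitWeight s (e s).2 = 1 ∨ |∏ s ∈ D, digitWeight s (e s).2| ≤ t⁻¹ := by
  have ht0 : 0 < t := by linarith
  induction D using Finset.induction_on with
  | empty => left; simp
  | insert s D hs ih =>
    have ih := ih fun s hs => hD s (Finset.mem_insert_of_mem hs)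
    have hst := hD s (Finset.mem_insert_self s D)
    rw [Finset.prod_insert hs]
    have hle1 : |∏ s ∈ D, digitWeight s (e s).2| ≤ 1 := by
      rcases ih with h | h
      · simp [h]
      · exact h.trans (inv_le_one_of_one_le₀ ht)
    by_cases h0 : ((e s).2 : ℕ) = 0
    · have : digitWeight s (e s).2 = 1 := if_pos h0
      rwa [this, one_mul]
    · right
      have h1 : digitWeight s (e s).2 = -((s : ℝ) - 1)⁻¹ := if_neg h0
      rw [abs_mul, h1, abs_neg, abs_of_nonneg (inv_nonneg.2 (by linarith))]
      have h2 : ((s : ℝ) - 1)⁻¹ ≤ t⁻¹ := inv_anti₀ ht0 hst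
      exact (mul_le_of_le_one_right (inv_nonneg.2 (by linarith)) hle1).trans h2

variable {p q r : m.primeFactors}

/-- The function on the roots of unity given by a tensor on the digits at three primes. -/
def tensorFunction (p q r : m.primeFactors)
    (x : Fin (p : ℕ) → Fin (q : ℕ) → Fin (r : ℕ) → ℕ) (e : RootIndex m) : ℝ :=
  open Classical in
  if ∀ s, ((e s).1 : ℕ) = 0 then
    (1 - (x (e p).2 (e q).2 (e r).2 : ℝ)) *
      ∏ s ∈ Finset.univ.filter (fun s => s ≠ p ∧ s ≠ q ∧ s ≠ r), digitWeight s (e s).2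
  else 0

/-- At p, q and r the line sums of 1 - x vanish, because each line of x sums to its length. At any
other prime the digit weights sum to zero. -/
theorem tensorFunction_hasZeroLineSums (hpq : p ≠ q) (hqr : q ≠ r) (hpr : p ≠ r)
    {x : Fin (p : ℕ) → Fin (q : ℕ) → Fin (r : ℕ) → ℕ} (hx : IsTransport x) :
    HasZeroLineSums (tensorFunction p q r x) := by
  classical
  intro e s
  unfold tensorFunction
  simp only [setDigit_fst]
  by_cases h0 : ∀ s, ((e s).1 : ℕ) = 0
  swap
  · simp only [if_neg h0, Finset.sum_const_zero]
  simp only [if_pos h0]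
  set D := Finset.univ.filter fun s : m.primeFactors => s ≠ p ∧ s ≠ q ∧ s ≠ r with hD
  have hprod : s ∉ D → ∀ j, ∏ t ∈ D, digitWeight t (setDigit e s j t).2
      = ∏ t ∈ D, digitWeight t (e t).2 := fun hs j =>
    Finset.prod_congr rfl fun t ht => by
      have hts : t ≠ s := by
        rintro rfl
        exact hs ht
      rw [setDigit_apply_of_ne e hts]
  by_cases hsp : s = p
  · subst hsp
    simp only [hprod (by simp [hD]), setDigit_apply_self, setDigit_apply_of_ne e hpq.symm,
      setDigit_apply_of_ne e hpr.symm, ← Finset.sum_mul, Finset.sum_sub_distrib]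
    rw [← Nat.cast_sum, hx.1]
    simp
  by_cases hsq : s = q
  · subst hsq
    simp only [hprod (by simp [hD]), setDigit_apply_self, setDigit_apply_of_ne e hpq,
      setDigit_apply_of_ne e hqr.symm, ← Finset.sum_mul, Finset.sum_sub_distrib]
    rw [← Nat.cast_sum, hx.2.1]
    simp
  by_cases hsr : s = r
  · subst hsr
    simp only [hprod (by simp [hD]), setDigit_apply_self, setDigit_apply_of_ne e hpr,
      setDigit_apply_of_ne e hqr, ← Finset.sum_mul, Finset.sum_sub_distrib]
    rw [← Nat.cast_sum, hx.2.2]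
    simp
  have hsD : s ∈ D := by simp [hD, hsp, hsq, hsr]
  simp only [setDigit_apply_of_ne e (Ne.symm hsp), setDigit_apply_of_ne e (Ne.symm hsq),
    setDigit_apply_of_ne e (Ne.symm hsr)]
  rw [← Finset.mul_sum]
  have : ∀ j, ∏ t ∈ D, digitWeight t (setDigit e s j t).2
      = digitWeight s j * ∏ t ∈ D.erase s, digitWeight t (e t).2 := by
    intro j
    rw [← Finset.mul_prod_erase _ _ hsD, setDigit_apply_self]
    congr 1
    exact Finset.prod_congr rfl fun t ht => by
      rw [setDigit_apply_of_ne e (Finset.ne_of_mem_erase ht)]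
  simp only [this, ← Finset.sum_mul, sum_digitWeight, zero_mul, mul_zero]

/-- The entries of x lie between 0 and p, as they sum to p along the first direction, so |1 - x| ≤ p
- 1. Minimality of p bounds the weight by 1/(p-1) whenever it is not 1. -/
theorem tensorFunction_le_one (hmin : ∀ s : m.primeFactors, (p : ℕ) ≤ s)
    {x : Fin (p : ℕ) → Fin (q : ℕ) → Fin (r : ℕ) → ℕ} (hx : IsTransport x) (e : RootIndex m) :
    tensorFunction p q r x e ≤ 1 := by
  classical
  unfold tensorFunction
  split_ifs
  swap
  · exact zero_le_one
  have hp2 : (2 : ℝ) ≤ p := by exact_mod_cast (Nat.prime_of_mem_primeFactors p.2).two_le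
  have hxp : (x (e p).2 (e q).2 (e r).2 : ℝ) ≤ p := by
    have h := Finset.single_le_sum (f := fun i => x i (e q).2 (e r).2)
      (fun i _ => Nat.zero_le _) (Finset.mem_univ (e p).2)
    rw [hx.1] at h
    exact_mod_cast h
  have hx0 : (0 : ℝ) ≤ x (e p).2 (e q).2 (e r).2 := Nat.cast_nonneg _
  set y : ℝ := ((x (e p).2 (e q).2 (e r).2 : ℕ) : ℝ)
  rcases prod_digitWeight (t := (p : ℝ) - 1) (by linarith) e
    (Finset.univ.filter fun s => s ≠ p ∧ s ≠ q ∧ s ≠ r)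
    (fun s _ => sub_le_sub_right (by exact_mod_cast hmin s) 1) with h | h
  · rw [h]; linarith
  · refine (le_abs_self _).trans ?_
    rw [abs_mul]
    have h1 : |1 - y| ≤ p - 1 := abs_le.2 ⟨by linarith, by linarith⟩
    calc _ ≤ ((p : ℝ) - 1) * ((p : ℝ) - 1)⁻¹ := by gcongr; linarith
      _ = 1 := mul_inv_cancel₀ (by linarith)

/-- The roots of unity of order dividing `p q r`. -/
def threeDigits (p q r : m.primeFactors) (t : Fin (p : ℕ) × Fin (q : ℕ) × Fin (r : ℕ)) :
    RootIndex m :=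
  setDigit (setDigit (setDigit (zeroIndex m) p t.1) q t.2.1) r t.2.2

theorem threeDigits_apply (hpq : p ≠ q) (hqr : q ≠ r) (hpr : p ≠ r)
    (t : Fin (p : ℕ) × Fin (q : ℕ) × Fin (r : ℕ)) :
    (threeDigits p q r t p).2 = t.1 ∧ (threeDigits p q r t q).2 = t.2.1 ∧
      (threeDigits p q r t r).2 = t.2.2 := by
  unfold threeDigits
  refine ⟨?_, ?_, ?_⟩
  · rw [setDigit_apply_of_ne _ hpr, setDigit_apply_of_ne _ hpq, setDigit_apply_self]
  · rw [setDigit_apply_of_ne _ hqr, setDigit_apply_self]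
  · rw [setDigit_apply_self]

theorem tensorFunction_threeDigits (hpq : p ≠ q) (hqr : q ≠ r) (hpr : p ≠ r)
    (x : Fin (p : ℕ) → Fin (q : ℕ) → Fin (r : ℕ) → ℕ)
    (t : Fin (p : ℕ) × Fin (q : ℕ) × Fin (r : ℕ)) :
    tensorFunction p q r x (threeDigits p q r t) = 1 - (x t.1 t.2.1 t.2.2 : ℝ) := by
  classical
  obtain ⟨h1, h2, h3⟩ := threeDigits_apply hpq hqr hpr t
  unfold tensorFunction
  rw [h1, h2, h3, if_pos fun s => by
      unfold threeDigits
      rw [setDigit_fst, setDigit_fst, setDigit_fst]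
      rfl, Finset.prod_eq_one, mul_one]
  intro s hs
  obtain ⟨-, hsp, hsq, hsr⟩ := Finset.mem_filter.1 hs
  unfold threeDigits
  rw [setDigit_apply_of_ne _ hsr, setDigit_apply_of_ne _ hsq, setDigit_apply_of_ne _ hsp]
  rfl

/-- If three primes divide `m`, some face of the cyclotomic polytope is not a simplex. -/
theorem exists_face_not_linearIndepOn (hm : m ≠ 0) (hpq : p ≠ q) (hqr : q ≠ r) (hpr : p ≠ r)
    (hmin : ∀ s : m.primeFactors, (p : ℕ) ≤ s) :
    ∃ G, IsFace (rootVector hm) G ∧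
      ¬LinearIndepOn ℝ (rootVector hm) (G : Set (RootIndex m)) := by
  classical
  have two : ∀ s : m.primeFactors, 2 ≤ (s : ℕ) := fun s =>
    (Nat.prime_of_mem_primeFactors s.2).two_le
  obtain ⟨x, hx, hcard⟩ := exists_degenerate_transport (two p) (two q) (two r)
  obtain ⟨a, ha⟩ := (tensorFunction_hasZeroLineSums hpq hqr hpr hx).exists_linearMap hm
  refine ⟨Finset.univ.filter fun e => a (rootVector hm e) = 1,
    ⟨a, fun e => (ha e).trans_le (tensorFunction_le_one hmin hx e), by simp⟩, fun hG => ?_⟩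
  have hinj : Function.Injective (threeDigits p q r) := by
    intro t t' h
    obtain ⟨h1, h2, h3⟩ := threeDigits_apply hpq hqr hpr t
    obtain ⟨h1', h2', h3'⟩ := threeDigits_apply hpq hqr hpr t'
    rw [h] at h1 h2 h3
    exact Prod.ext (h1.symm.trans h1') (Prod.ext (h2.symm.trans h2') (h3.symm.trans h3'))
  set S := Finset.univ.filter fun t : Fin (p : ℕ) × Fin (q : ℕ) × Fin (r : ℕ) =>
    x t.1 t.2.1 t.2.2 = 0 with hS
  have hmem : ∀ t : (S : Set (Fin (p : ℕ) × Fin (q : ℕ) × Fin (r : ℕ))), threeDigits p q r t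
      ∈ ((Finset.univ.filter fun e => a (rootVector hm e) = 1 : Finset _) : Set (RootIndex m)) := by
    rintro ⟨t, ht⟩
    have ht0 : x t.1 t.2.1 t.2.2 = 0 := (Finset.mem_filter.1 ht).2
    simp only [Finset.coe_filter, Finset.mem_univ, true_and, Set.mem_ofPred_eq]
    rw [ha, tensorFunction_threeDigits hpq hqr hpr, ht0]
    simp
  have hind : LinearIndepOn ℝ (fun t => rootVector hm (threeDigits p q r t))
      (S : Set (Fin (p : ℕ) × Fin (q : ℕ) × Fin (r : ℕ))) :=
    LinearIndependent.comp hG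
      (fun t : (S : Set (Fin (p : ℕ) × Fin (q : ℕ) × Fin (r : ℕ))) =>
        ⟨threeDigits p q r t, hmem t⟩)
      fun t t' h => Subtype.ext (hinj (congrArg Subtype.val h))
  have hz := rootVector_hasZeroLineSums hm
  -- The zeros of x give roots on the face. They are more numerous than (p-1)(q-1)(r-1), the largest
  -- size of an independent set in a grid with vanishing line sums.
  refine absurd hcard (not_lt.2 (card_le_of_linearIndepOn_grid (pos_of_mem p) (pos_of_mem q)
    (pos_of_mem r) (fun j k => ?_) (fun i k => ?_) (fun i j => ?_) hind))
  · simp only [threeDigits]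
    refine Eq.trans (Finset.sum_congr rfl fun i _ => ?_)
      (hz (setDigit (setDigit (zeroIndex m) q j) r k) p)
    rw [setDigit_comm _ hpq, setDigit_comm _ hpr]
  · simp only [threeDigits]
    refine Eq.trans (Finset.sum_congr rfl fun j _ => ?_)
      (hz (setDigit (setDigit (zeroIndex m) p i) r k) q)
    rw [setDigit_comm _ hqr]
  · exact hz (setDigit (setDigit (zeroIndex m) p i) q j) r

end ThreePrimes

/-! ### The case m > 1 -/

theorem exists_two_primes {m : ℕ} (hm : 1 < m)
    (h3 : ∀ p q r : m.primeFactors, p ≠ q → q ≠ r → p ≠ r → ¬∀ s : m.primeFactors, (p : ℕ) ≤ s) :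
    ∃ p q : m.primeFactors, ∀ r, r = p ∨ r = q := by
  have : Nonempty m.primeFactors := (Nat.nonempty_primeFactors.2 hm).to_subtype
  obtain ⟨p, -, hp⟩ := Finset.exists_min_image Finset.univ
    (fun s : m.primeFactors => (s : ℕ)) Finset.univ_nonempty
  by_cases hq : ∃ q, q ≠ p
  · obtain ⟨q, hq⟩ := hq
    refine ⟨p, q, fun r => ?_⟩
    by_contra! hr
    exact h3 p q r hq.symm hr.2.symm hr.1.symm fun s => hp s (Finset.mem_univ s)
  · push Not at hq
    -- For a prime power the two primes may coincide.
    exact ⟨p, p, fun r => Or.inl (hq r)⟩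

theorem isCoordinatorPolynomial_of_one_lt {m : ℕ} (hm : 1 < m)
    (hsimp : IsSimplicial (cyclotomicPolytope m)) :
    IsCoordinatorPolynomial (latticeRootsOfUnity m) (hPolynomial (cyclotomicPolytope m)) := by
  have hm0 : m ≠ 0 := by omega
  rw [cyclotomicPolytope_eq hm0] at hsimp ⊢
  have : Nonempty (RootIndex m) := ⟨zeroIndex m⟩
  have hspan := span_rootVector hm0
  obtain ⟨p₀, hp₀⟩ := Nat.nonempty_primeFactors.2 hm
  have hsum := sum_rootVector hm0 ⟨p₀, hp₀⟩
  have hind : ∀ G, IsFace (rootVector hm0) G → LinearIndepOn ℝ (rootVector hm0)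
      (G : Set (RootIndex m)) := fun G hG =>
    linearIndepOn_of_isSimplicial (exists_supporting_functional hm0)
      (interior_subset (zero_mem_interior_convexHull hsum hspan)) hsimp hG
  -- Simpliciality excludes a third prime, which makes the rounding argument available.
  obtain ⟨p, q, hpq⟩ := exists_two_primes hm fun p q r h1 h2 h3 hmin => by
    obtain ⟨G, hG, hG'⟩ := exists_face_not_linearIndepOn hm0 h1 h2 h3 hmin
    exact hG' (hind G hG)
  unfold IsCoordinatorPolynomial
  rw [← range_latticeRoot hm0, finrank_cyclotomicLattice hm0]
  exact growthSeries_mul_eq_hPolynomial hsum hspan hind (latticeCoord_injective hm0)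
    (fun _ => rfl) fun G hG α l hl => exists_int_coord hm0 hpq (hind G hG) α l hl

/-! ### The trivial case -/

theorem latticeRootsOfUnity_one : latticeRootsOfUnity 1 = {1} := by
  ext x
  simp [latticeRootsOfUnity]

theorem hasWordLength_singleton_iff {L : Type*} [AddCommGroup L] {v : L}
    (hv : Function.Injective fun n : ℕ => n • v) {x : L} {n : ℕ} : HasWordLength {v} x n ↔ x = n • v := by
  have h : ∀ k, IsSumOfTerms {v} x k ↔ x = k • v := by
    intro k
    constructor
    · rintro ⟨s, rfl, hs, rfl⟩
      rw [Multiset.eq_replicate_card.2 hs, Multiset.sum_replicate, Multiset.card_replicate]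
    · rintro rfl
      exact ⟨Multiset.replicate k v, by simp, fun y hy => Multiset.eq_of_mem_replicate hy, by simp⟩
  unfold HasWordLength
  simp only [h]
  constructor
  · exact fun h => h.1
  · rintro rfl
    exact ⟨rfl, fun k hk => (hv hk).le⟩

theorem growthSeries_singleton {L : Type*} [AddCommGroup L] {v : L}
    (hv : Function.Injective fun n : ℕ => n • v) : growthSeries {v} = PowerSeries.mk fun _ => 1 := by
  ext n
  simp [growthSeries, coordinationSequence, hasWordLength_singleton_iff hv]

theorem hPolynomial_singleton {E : Type*} [AddCommGroup E] [Module ℝ E] [TopologicalSpace E]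
    (v : E) : hPolynomial ({v} : Set E) = 1 := by
  have hdim : affineDim ({v} : Set E) = 0 := by
    simp [affineDim]
  have hempty : ∀ F : Set E, affineDim F = -1 ↔ F = ∅ := by
    intro F
    unfold affineDim
    split_ifs with h
    · simp [h]
    · simp only [h]
  have hface : faceNumber ({v} : Set E) (-1) = 1 := by
    rw [faceNumber, Nat.card_eq_one_iff_unique]
    refine ⟨⟨fun F G => Subtype.ext ?_⟩, ⟨⟨∅, isExposed_empty, (hempty _).2 rfl⟩⟩⟩
    rw [(hempty _).1 F.2.2, (hempty _).1 G.2.2]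
  simp [hPolynomial, hdim, hface]

/-- The only root of unity is 1, so the roots do not sum to zero and the fan argument does not
apply. The polytope has dimension 0 while the lattice has rank 1; still, the h-polynomial is 1 and
the growth series is 1/(1-x). -/
theorem isCoordinatorPolynomial_one :
    IsCoordinatorPolynomial (latticeRootsOfUnity 1) (hPolynomial (cyclotomicPolytope 1)) := by
  have hcard : Fintype.card (RootIndex 1) = 1 := card_rootIndex one_ne_zero
  obtain ⟨e, he⟩ := Fintype.card_eq_one_iff.1 hcard
  have hP : cyclotomicPolytope 1 = {rootVector one_ne_zero e} := by
    rw [cyclotomicPolytope_eq one_ne_zero]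
    have : Set.range (rootVector one_ne_zero) = {rootVector one_ne_zero e} := by
      ext v
      constructor
      · rintro ⟨e', rfl⟩
        rw [he e']
        rfl
      · rintro rfl
        exact ⟨e, rfl⟩
    rw [this, convexHull_singleton]
  have hrank : Module.finrank ℤ (cyclotomicLattice 1) = 1 := by
    rw [Module.finrank_eq_card_basis (latticeBasis one_ne_zero), card_basisIndex one_ne_zero,
      Nat.totient_one]
  unfold IsCoordinatorPolynomial
  have hinj : Function.Injective fun n : ℕ => n • (1 : cyclotomicLattice 1) := fun a b h => by
    simpa using congrArg Subtype.val h
  rw [hP, hPolynomial_singleton, latticeRootsOfUnity_one, growthSeries_singleton hinj, hrank,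
    pow_one, Polynomial.coe_one]
  exact PowerSeries.mk_one_mul_one_sub_eq_one ℤ

end CyclotomicCoordinator

end

theorem mainTheorem9 (m : ℕ) (hm : 0 < m)
    (hsimp : CyclotomicCoordinator.IsSimplicial (CyclotomicCoordinator.cyclotomicPolytope m)) :
    CyclotomicCoordinator.IsCoordinatorPolynomial
      (CyclotomicCoordinator.latticeRootsOfUnity m)
      (CyclotomicCoordinator.hPolynomial (CyclotomicCoordinator.cyclotomicPolytope m)) := by
  rcases (Nat.one_le_iff_ne_zero.2 hm.ne').eq_or_lt with rfl | hm
  · exact CyclotomicCoordinator.isCoordinatorPolynomial_one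
  · exact CyclotomicCoordinator.isCoordinatorPolynomial_of_one_lt hm hsimp
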